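/- All maps are $C^\infty$; $I_1,I_2$ are open intervals of $\mathbb R$, $U_1,U_2$ are open subsets of $\mathbb R^s$, and $(\bar u_i,t_i)\in U_i\times I_i$ $(i=1,2)$. **Definitions.** (a) For a map $g_i$ from $U_i\times I_i$ to $\mathbb R^m$ put $\bar g_i(u,t)=(g_i(u,t),t)$. For set germs $Y_i,Z_i$ in $\mathbb R^m\times\mathbb R$ at $(y_i,t_i)$ we write $K(Y_1,Z_1;(y_1,t_1))=K(Y_2,Z_2;(y_2,t_2))$, and say that the two contacts are of the same type, if there is a diffeomorphism germ $\Phi:(\mathbb R^m\times\mathbb R,(y_1,t_1))\to(\mathbb R^m\times\mathbb R,(y_2,t_2))$ of the form $\Phi(y,t)=(\phi_1(y,t),\phi_2(t))$ such that $\Phi(Y_1)=Y_2$ and $\Phi(Z_1)=Z_2$ as set germs. (b) Function germs $h_i$ at $(\bar u_i,t_i)\in\mathbb R^s\times\mathbb R$ are $P$-$\mathcal K$-equivalent if there are a diffeomorphism germ $\Psi:(\mathbb R^s\times\mathbb R,(\bar u_1,t_1))\to(\mathbb R^s\times\mathbb R,(\bar u_2,t_2))$ of the form $\Psi(u,t)=(\psi_1(u,t),\psi_2(t))$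 and a smooth function germ $\lambda$ at $(\bar u_1,t_1)$ with $\lambda(\bar u_1,t_1)\neq0$ such that $h_2\circ\Psi=\lambda\cdot h_1$. (c) On $\mathbb R^{n+1}$ let $\langle x,y\rangle=-x_0y_0+\sum_{i=1}^nx_iy_i$, $e_0=(1,0,\dots,0)$, $LC^*=\{x\mid x_0\ne0,\ \langle x,x\rangle=0\}$, $HP(v,c)=\{x\mid\langle x,v\rangle=c\}$, and $\widetilde x=(1,x_1/x_0,\dots,x_n/x_0)$ if $x_0\neq0$. A world sheet is an embedding $X:U\times I\to\mathbb R^{n+1}$ such that the image $W$ is time-orientable, all tangent spaces $T_pW$ are Lorentz subspaces and every momentary space $\mathcal S_t=X(U\times\{t\})$ is spacelike. Let $n^T(u,t)$ be the unique vector of $T_pW$, $p=X(u,t)$, that is pseudo-orthogonal to $T_p\mathcal S_t$ and satisfies $\langle n^T,n^T\rangle=-1$ and $\langle n^T,e_0\rangle<0$. Let $N_1[\mathcal S_t]_p$ be the set of vectors $\xi$ pseudo-orthogonal to $T_p\mathcal S_t$ and to $n^T(u,t)$ with $\langle\xi,\xi\rangle=1$. For such $\xi$ let $L=\widetilde{n^T(u,t)+\xi}$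 and $\mathbb{LP}(\mathcal S_t)((u,t),\xi)=\langle X(u,t),L\rangle L$. If $v=\mathbb{LP}(\mathcal S_t)((u,t),\xi)$ lies in $LC^*$, i.e. $v\ne 0$, the tangent lightlike hyperplane is $TLP(\mathcal S_t,v,\xi)=HP(\widetilde v,v_0)$. For $v\in LC^*$ put $\widetilde h_v(u,t)=\langle X(u,t),\widetilde v\rangle-v_0$. **Parametric Montaldi theorem.** Let $g_i:U_i\times I_i\to\mathbb R^m$ be such that every $u\mapsto g_i(u,t)$ is an immersion and $\bar g_i$ is a homeomorphism onto its image $\overline Y_i=\bar g_i(U_i\times I_i)$; put $y_i=g_i(\bar u_i,t_i)$, and let $f_i:(\mathbb R^m,y_i)\to(\mathbb R,0)$ be submersion germs with zero sets $V(f_i)$. Then $$K(\overline Y_1,V(f_1)\times I_1;(y_1,t_1))=K(\overline Y_2,V(f_2)\times I_2;(y_2,t_2))$$ if and only if $f_1\circ g_1$ at $(\bar u_1,t_1)$ and $f_2\circ g_2$ at $(\bar u_2,t_2)$ are $P$-$\mathcal K$-equivalent. **World sheets.** Let $X_i:U_i\times I_i\to\mathbb R^{n+1}$ be world sheets, $p_i=X_i(\bar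 u_i,t_i)$, $\xi_i\in N_1[\mathcal S_{t_i}]_{p_i}$, and suppose that $v_i=\mathbb{LP}(\mathcal S_{t_i})((\bar u_i,t_i),\xi_i)$ lies in $LC^*$ $(i=1,2)$. Let $\overline W_i=\{(X_i(u,t),t)\mid(u,t)\in U_i\times I_i\}$. Then $$K(\overline W_1,TLP(\mathcal S_{t_1},v_1,\xi_1)\times I_1;(p_1,t_1))=K(\overline W_2,TLP(\mathcal S_{t_2},v_2,\xi_2)\times I_2;(p_2,t_2))$$ if and only if $\widetilde h_{1,v_1}$ at $(\bar u_1,t_1)$ and $\widetilde h_{2,v_2}$ at $(\bar u_2,t_2)$ are $P$-$\mathcal K$-equivalent. -/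

import Mathlib

open Set Filter Topology
open scoped ContDiff

noncomputable section

/-! ### Germs of diffeomorphisms, contact and `P`-`𝒦`-equivalence -/

/-- `Φ` represents a smooth diffeomorphism germ `(E × ℝ, a) → (E × ℝ, b)` of the form
`Φ (x, t) = (φ₁ (x, t), φ₂ t)`. -/
structure IsParamDiffeoGerm {E : Type*} [NormedAddCommGroup E] [NormedSpace ℝ E]
    (Φ : OpenPartialHomeomorph (E × ℝ) (E × ℝ)) (a b : E × ℝ) : Prop where
  mem_source : a ∈ Φ.source
  map_base : Φ a = b
  smooth : ContDiffOn ℝ ∞ Φ Φ.source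
  smooth_symm : ContDiffOn ℝ ∞ Φ.symm Φ.target
  time : ∃ φ₂ : ℝ → ℝ, ∀ z ∈ Φ.source, (Φ z).2 = φ₂ z.2

/-- `K(Y₁, Z₁; a₁) = K(Y₂, Z₂; a₂)`: there is a diffeomorphism germ `Φ (y, t) = (φ₁ (y, t), φ₂ t)`
with `Φ a₁ = a₂` that maps the set germ `(Y₁, a₁)` onto `(Y₂, a₂)` and the set germ `(Z₁, a₁)`
onto `(Z₂, a₂)`. -/
def SameContactType {E : Type*} [NormedAddCommGroup E] [NormedSpace ℝ E]
    (Y₁ Z₁ : Set (E × ℝ)) (a₁ : E × ℝ) (Y₂ Z₂ : Set (E × ℝ)) (a₂ : E × ℝ) : Prop :=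
  ∃ Φ : OpenPartialHomeomorph (E × ℝ) (E × ℝ), IsParamDiffeoGerm Φ a₁ a₂ ∧
    (∀ᶠ z in 𝓝 a₁, z ∈ Y₁ ↔ Φ z ∈ Y₂) ∧ (∀ᶠ z in 𝓝 a₁, z ∈ Z₁ ↔ Φ z ∈ Z₂)

/-- `f` represents a smooth germ at `a`: it is smooth on a neighbourhood of `a`. -/
def IsSmoothGerm {E F : Type*} [NormedAddCommGroup E] [NormedSpace ℝ E]
    [NormedAddCommGroup F] [NormedSpace ℝ F] (f : E → F) (a : E) : Prop :=
  ∀ᶠ x in 𝓝 a, ContDiffAt ℝ ∞ f x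

/-- The function germs `h₁` at `q₁` and `h₂` at `q₂` are `P`-`𝒦`-equivalent:
`h₂ ∘ Ψ = l • h₁` near `q₁`, for a diffeomorphism germ `Ψ (u, t) = (ψ₁ (u, t), ψ₂ t)` with
`Ψ q₁ = q₂` and a smooth function germ `l` with `l q₁ ≠ 0`. -/
def PKEquivalent {E : Type*} [NormedAddCommGroup E] [NormedSpace ℝ E]
    (h₁ : E × ℝ → ℝ) (q₁ : E × ℝ) (h₂ : E × ℝ → ℝ) (q₂ : E × ℝ) : Prop :=
  ∃ (Ψ : OpenPartialHomeomorph (E × ℝ) (E × ℝ)) (l : E × ℝ → ℝ), IsParamDiffeoGerm Ψ q₁ q₂ ∧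
    IsSmoothGerm l q₁ ∧ l q₁ ≠ 0 ∧ ∀ᶠ q in 𝓝 q₁, h₂ (Ψ q) = l q * h₁ q

/-! ### One-parameter families of immersions -/

/-- The map `(u, t) ↦ (g (u, t), t)`. -/
def graphMap {E F : Type*} (g : E × ℝ → F) (q : E × ℝ) : F × ℝ := (g q, q.2)

/-- `g : U × I → ℝᵐ` is a smooth family, with parameter `t ∈ I` in an open interval, of immersions
`u ↦ g (u, t)`, and `(u, t) ↦ (g (u, t), t)` is a homeomorphism onto its image. -/
structure IsImmersedFamily {r m : ℕ} (U : Set (Fin r → ℝ)) (I : Set ℝ)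
    (g : (Fin r → ℝ) × ℝ → (Fin m → ℝ)) : Prop where
  isOpen_space : IsOpen U
  isOpen_time : IsOpen I
  interval : I.OrdConnected
  smooth : ContDiffOn ℝ ∞ g (U ×ˢ I)
  immersion : ∀ u ∈ U, ∀ t ∈ I, Function.Injective (fderiv ℝ (fun u' => g (u', t)) u)
  embedding : IsEmbedding ((U ×ˢ I).domRestrict (graphMap g))

/-- `f` represents a smooth submersion germ `(ℝᵐ, y) → (ℝ, 0)`. -/
structure IsSubmersionGerm {m : ℕ} (f : (Fin m → ℝ) → ℝ) (y : Fin m → ℝ) : Prop where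
  smooth : IsSmoothGerm f y
  map_base : f y = 0
  submersion : Function.Surjective (fderiv ℝ f y)

/-! ### Lorentz-Minkowski space -/

/-- The pseudo scalar product `-x₀ y₀ + ∑ xᵢ yᵢ` on `ℝⁿ⁺¹`. -/
def mink {n : ℕ} (x y : Fin (n + 1) → ℝ) : ℝ :=
  -(x 0 * y 0) + ∑ i : Fin n, x i.succ * y i.succ

/-- The future timelike vector `e₀ = (1, 0, …, 0)`. -/
def timeVec {n : ℕ} : Fin (n + 1) → ℝ := Pi.single 0 1

/-- A spacelike subspace: the pseudo scalar product is positive definite on it. -/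
def IsSpacelikeSubspace {n : ℕ} (S : Submodule ℝ (Fin (n + 1) → ℝ)) : Prop :=
  ∀ w ∈ S, w ≠ 0 → 0 < mink w w

/-- A timelike (Lorentz) subspace: the pseudo scalar product has signature `(-, +, …, +)` on it. -/
def IsTimelikeSubspace {n : ℕ} (S : Submodule ℝ (Fin (n + 1) → ℝ)) : Prop :=
  ∃ v ∈ S, mink v v < 0 ∧ ∀ w ∈ S, mink v w = 0 → w ≠ 0 → 0 < mink w w

/-- The hyperplane `HP(v, c)` with pseudo normal `v`. -/
def hyperplane {n : ℕ} (v : Fin (n + 1) → ℝ) (c : ℝ) : Set (Fin (n + 1) → ℝ) :=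
  {x | mink x v = c}

/-- The open lightcone `LC*`. -/
def lightcone (n : ℕ) : Set (Fin (n + 1) → ℝ) := {x | x 0 ≠ 0 ∧ mink x x = 0}

/-- The normalization `x̃ = (1, x₁ / x₀, …, xₙ / x₀)`, for `x₀ ≠ 0`. -/
def normalized {n : ℕ} (x : Fin (n + 1) → ℝ) : Fin (n + 1) → ℝ :=
  Fin.cons 1 fun i : Fin n => x i.succ / x 0

/-! ### World sheets -/

/-- The tangent space of `W = X (U × I)` at `X q`. -/
def tangentSheet {s n : ℕ} (X : (Fin s → ℝ) × ℝ → (Fin (n + 1) → ℝ)) (q : (Fin s → ℝ) × ℝ) :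
    Submodule ℝ (Fin (n + 1) → ℝ) :=
  LinearMap.range (fderiv ℝ X q).toLinearMap

/-- The tangent space of the momentary space `S_t = X (U × {t})` at `X (u, t)`, spanned by the
partial derivatives of `X` along the coordinates of `u`. -/
def tangentMomentary {s n : ℕ} (X : (Fin s → ℝ) × ℝ → (Fin (n + 1) → ℝ)) (q : (Fin s → ℝ) × ℝ) :
    Submodule ℝ (Fin (n + 1) → ℝ) :=
  LinearMap.range ((fderiv ℝ X q).toLinearMap ∘ₗ LinearMap.inl ℝ (Fin s → ℝ) ℝ)

/-- `X : U × I → ℝⁿ⁺¹₁` is a world sheet: a smooth timelike embedding with time-orientable image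
all of whose momentary spaces are spacelike. -/
structure IsWorldSheet {s n : ℕ} (U : Set (Fin s → ℝ)) (I : Set ℝ)
    (X : (Fin s → ℝ) × ℝ → (Fin (n + 1) → ℝ)) : Prop where
  isOpen_space : IsOpen U
  isOpen_time : IsOpen I
  interval : I.OrdConnected
  smooth : ContDiffOn ℝ ∞ X (U ×ˢ I)
  immersion : ∀ q ∈ U ×ˢ I, Function.Injective (fderiv ℝ X q)
  embedding : IsEmbedding ((U ×ˢ I).domRestrict X)
  timelike : ∀ q ∈ U ×ˢ I, IsTimelikeSubspace (tangentSheet X q)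
  spacelike : ∀ q ∈ U ×ˢ I, IsSpacelikeSubspace (tangentMomentary X q)
  timeOrientable : ∃ τ : (Fin s → ℝ) × ℝ → (Fin (n + 1) → ℝ), ContDiffOn ℝ ∞ τ (U ×ˢ I) ∧
    ∀ q ∈ U ×ˢ I, τ q ∈ tangentSheet X q ∧ mink (τ q) (τ q) < 0

/-- `ν` is a future directed timelike unit vector at `X q`, tangent to `W` and pseudo-normal to the
momentary space. -/
structure IsFutureNormal {s n : ℕ} (X : (Fin s → ℝ) × ℝ → (Fin (n + 1) → ℝ))
    (q : (Fin s → ℝ) × ℝ) (ν : Fin (n + 1) → ℝ) : Prop where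
  tangent : ν ∈ tangentSheet X q
  normal : ∀ w ∈ tangentMomentary X q, mink w ν = 0
  unit : mink ν ν = -1
  future : mink ν timeVec < 0

/-- The vector `nᵀ(u, t)`: the vector `ν` with `IsFutureNormal X (u, t) ν`, which exists and is
unique for a world sheet (see `IsWorldSheet.existsUnique_futureNormal`). -/
def futureNormal {s n : ℕ} (X : (Fin s → ℝ) × ℝ → (Fin (n + 1) → ℝ)) (q : (Fin s → ℝ) × ℝ) :
    Fin (n + 1) → ℝ :=
  Classical.epsilon (IsFutureNormal X q)

/-- The fibre `N₁[S_t]_p` at `p = X (u, t)`: the unit spacelike pseudo-normal vectors of `S_t` that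
are pseudo-orthogonal to `nᵀ(u, t)`. -/
def unitNormals {s n : ℕ} (X : (Fin s → ℝ) × ℝ → (Fin (n + 1) → ℝ)) (q : (Fin s → ℝ) × ℝ) :
    Set (Fin (n + 1) → ℝ) :=
  {ξ | (∀ w ∈ tangentMomentary X q, mink w ξ = 0) ∧ mink ξ ξ = 1 ∧ mink ξ (futureNormal X q) = 0}

/-- The normalized momentary lightcone Gauss map: the normalization of `nᵀ(u, t) + ξ`. -/
def lightconeGauss {s n : ℕ} (X : (Fin s → ℝ) × ℝ → (Fin (n + 1) → ℝ)) (q : (Fin s → ℝ) × ℝ)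
    (ξ : Fin (n + 1) → ℝ) : Fin (n + 1) → ℝ :=
  normalized (futureNormal X q + ξ)

/-- The momentary lightcone pedal map `LP(S_t)((u, t), ξ)`. -/
def lightconePedal {s n : ℕ} (X : (Fin s → ℝ) × ℝ → (Fin (n + 1) → ℝ)) (q : (Fin s → ℝ) × ℝ)
    (ξ : Fin (n + 1) → ℝ) : Fin (n + 1) → ℝ :=
  mink (X q) (lightconeGauss X q ξ) • lightconeGauss X q ξ

/-- The tangent lightlike hyperplane `TLP(S_t, v, ξ) = HP(ṽ, v₀)`, where
`v = LP(S_t)((u, t), ξ)`. -/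
def tangentLightlikeHyperplane {s n : ℕ} (X : (Fin s → ℝ) × ℝ → (Fin (n + 1) → ℝ))
    (q : (Fin s → ℝ) × ℝ) (ξ : Fin (n + 1) → ℝ) : Set (Fin (n + 1) → ℝ) :=
  hyperplane (normalized (lightconePedal X q ξ)) (lightconePedal X q ξ 0)

/-- The extended lightcone height function `h̃_v (u, t) = ⟨X (u, t), ṽ⟩ - v₀`. -/
def extendedHeight {s n : ℕ} (X : (Fin s → ℝ) × ℝ → (Fin (n + 1) → ℝ)) (v : Fin (n + 1) → ℝ)
    (q : (Fin s → ℝ) × ℝ) : ℝ :=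
  mink (X q) (normalized v) - v 0

theorem mink_add_left {n : ℕ} (x y z : Fin (n + 1) → ℝ) : mink (x + y) z = mink x z + mink y z := by
  simp only [mink, Pi.add_apply, add_mul, Finset.sum_add_distrib]; ring

theorem mink_smul_left {n : ℕ} (c : ℝ) (x z : Fin (n + 1) → ℝ) : mink (c • x) z = c * mink x z := by
  simp only [mink, Pi.smul_apply, smul_eq_mul, mul_assoc, ← Finset.mul_sum]; ring

theorem mink_comm {n : ℕ} (x y : Fin (n + 1) → ℝ) : mink x y = mink y x := by
  simp only [mink, mul_comm]

/-- The pseudo scalar product as a bilinear form. -/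
def minkForm (n : ℕ) : LinearMap.BilinForm ℝ (Fin (n + 1) → ℝ) :=
  LinearMap.mk₂ ℝ mink mink_add_left mink_smul_left
    (fun x y z => by rw [mink_comm, mink_add_left, mink_comm y, mink_comm z])
    (fun c x z => by rw [mink_comm, mink_smul_left, mink_comm z]; rfl)

/-- Pseudo-orthogonal projection to a spacelike subspace. -/
theorem IsSpacelikeSubspace.exists_proj {n : ℕ} {S : Submodule ℝ (Fin (n + 1) → ℝ)}
    (hS : IsSpacelikeSubspace S) (v : Fin (n + 1) → ℝ) :
    ∃ w ∈ S, ∀ x ∈ S, mink x (v - w) = 0 := by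
  have hsymm : (minkForm n).IsRefl := fun x y h => by
    change mink y x = 0; rw [mink_comm]; exact h
  have hnd : ((minkForm n).restrict S).Nondegenerate := by
    refine (LinearMap.IsRefl.nondegenerate_iff_separatingLeft ?_).2 ?_
    · intro x y h; exact hsymm _ _ h
    · intro x hx
      by_contra hne
      have h1 := hS x x.2 (fun h => hne (Subtype.ext h))
      have h2 : mink (x : Fin (n + 1) → ℝ) x = 0 := hx x
      linarith
  have hc := LinearMap.BilinForm.isCompl_orthogonal_of_restrict_nondegenerate hsymm hnd
  have hv : v ∈ S ⊔ (minkForm n).orthogonal S := by rw [hc.sup_eq_top]; trivial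
  obtain ⟨w, hw, m, hm, rfl⟩ := Submodule.mem_sup.1 hv
  refine ⟨w, hw, fun x hx => ?_⟩
  rw [add_sub_cancel_left]
  exact hm x hx

theorem tangentMomentary_le {s n : ℕ} (X : (Fin s → ℝ) × ℝ → (Fin (n + 1) → ℝ))
    (q : (Fin s → ℝ) × ℝ) : tangentMomentary X q ≤ tangentSheet X q :=
  LinearMap.range_comp_le_range _ _

theorem mink_self_timeVec {n : ℕ} (x : Fin (n + 1) → ℝ) : mink x timeVec = -x 0 := by
  simp [mink, timeVec, Fin.succ_ne_zero]

theorem head_ne_zero_of_mink_neg {n : ℕ} {x : Fin (n + 1) → ℝ} (h : mink x x < 0) : x 0 ≠ 0 := by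
  intro h0
  have : 0 ≤ ∑ i : Fin n, x i.succ * x i.succ := Finset.sum_nonneg fun i _ => mul_self_nonneg _
  simp only [mink, h0] at h
  linarith

/-- For a world sheet the future directed timelike unit normal of the momentary space that is
tangent to `W` exists and is unique. -/
theorem IsWorldSheet.existsUnique_futureNormal {s n : ℕ} {U : Set (Fin s → ℝ)} {I : Set ℝ}
    {X : (Fin s → ℝ) × ℝ → (Fin (n + 1) → ℝ)} (hX : IsWorldSheet U I X) {q : (Fin s → ℝ) × ℝ}
    (hq : q ∈ U ×ˢ I) : ∃! ν, IsFutureNormal X q ν := by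
  obtain ⟨v, hvT, hv, -⟩ := hX.timelike q hq
  have hS := hX.spacelike q hq
  obtain ⟨w, hwS, hw⟩ := hS.exists_proj v
  obtain ⟨m, hm⟩ : ∃ m, m = v - w := ⟨_, rfl⟩
  have hvm : v = w + m := by rw [hm]; abel
  rw [← hm] at hw
  have hmT : m ∈ tangentSheet X q := hm ▸ Submodule.sub_mem _ hvT (tangentMomentary_le X q hwS)
  have hmm : mink m m < 0 := by
    have h1 : mink v v = mink w w + mink m m := by
      have h2 := hw w hwS
      rw [hvm, mink_add_left, mink_comm w, mink_comm m, mink_add_left, mink_add_left,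
        mink_comm m w, h2]; ring
    have h3 : 0 ≤ mink w w := by
      by_cases h0 : w = 0
      · simp [h0, mink]
      · exact (hS w hwS h0).le
    linarith
  have hm0 := head_ne_zero_of_mink_neg hmm
  -- the normalization of `m`
  have hex : ∃ c : ℝ, c * c * mink m m = -1 ∧ 0 < c * m 0 := by
    have hs : 0 < √(-mink m m) := Real.sqrt_pos.2 (by linarith)
    have hs2 : √(-mink m m) * √(-mink m m) = -mink m m := Real.mul_self_sqrt (by linarith)
    have key : (√(-mink m m))⁻¹ * (√(-mink m m))⁻¹ * mink m m = -1 := by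
      rw [← mul_inv, hs2, inv_neg, neg_mul, inv_mul_cancel₀ hmm.ne]
    rcases lt_or_gt_of_ne hm0 with h | h
    · exact ⟨-(√(-mink m m))⁻¹, by rw [neg_mul_neg, key],
        mul_pos_of_neg_of_neg (neg_neg_of_pos (inv_pos.2 hs)) h⟩
    · exact ⟨(√(-mink m m))⁻¹, key, mul_pos (inv_pos.2 hs) h⟩
  obtain ⟨c, hc1, hc0⟩ := hex
  have hν : IsFutureNormal X q (c • m) := by
    refine ⟨Submodule.smul_mem _ _ hmT, fun x hx => ?_, ?_, ?_⟩
    · rw [mink_comm, mink_smul_left, mink_comm, hw x hx, mul_zero]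
    · rw [mink_smul_left, mink_comm, mink_smul_left, ← mul_assoc, hc1]
    · rw [mink_self_timeVec]
      simpa using hc0
  refine ⟨c • m, hν, fun ν h => ?_⟩
  generalize c • m = μ at hν
  -- `μ` and `ν` are proportional modulo the momentary tangent space
  obtain ⟨⟨a, τ⟩, ha⟩ := hν.tangent
  obtain ⟨⟨b, σ⟩, hb⟩ := h.tangent
  have hτ : τ ≠ 0 := by
    rintro rfl
    have hμS : μ ∈ tangentMomentary X q := ⟨a, ha⟩
    have h1 := hν.normal μ hμS
    have h2 := hν.unit
    linarith
  have hd : ν - (σ / τ) • μ ∈ tangentMomentary X q := by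
    refine ⟨b - (σ / τ) • a, ?_⟩
    rw [← ha, ← hb, ← map_smul, ← map_sub]
    simp [hτ]
  have hd0 : ν - (σ / τ) • μ = 0 := by
    by_contra hne
    have h1 := hS _ hd hne
    have h2 : mink (ν - (σ / τ) • μ) (ν - (σ / τ) • μ) = 0 := by
      nth_rw 2 [sub_eq_add_neg]
      rw [← neg_smul, mink_comm, mink_add_left, mink_smul_left, mink_comm, h.normal _ hd, mink_comm μ,
        hν.normal _ hd]
      ring
    linarith
  have hνμ : ν = (σ / τ) • μ := sub_eq_zero.1 hd0
  generalize σ / τ = k at hνμ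
  have hk : k * k = 1 := by
    have h1 := h.unit
    rw [hνμ, mink_smul_left, mink_comm, mink_smul_left, hν.unit] at h1
    linarith
  have hkpos : 0 < k := by
    have h1 := h.future
    have h2 := hν.future
    rw [hνμ, mink_smul_left] at h1
    by_contra hk0
    nlinarith
  have : k = 1 := by nlinarith
  rw [hνμ, this, one_smul]

theorem IsWorldSheet.isFutureNormal {s n : ℕ} {U : Set (Fin s → ℝ)} {I : Set ℝ}
    {X : (Fin s → ℝ) × ℝ → (Fin (n + 1) → ℝ)} (hX : IsWorldSheet U I X) {q : (Fin s → ℝ) × ℝ}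
    (hq : q ∈ U ×ˢ I) : IsFutureNormal X q (futureNormal X q) :=
  Classical.epsilon_spec (hX.existsUnique_futureNormal hq).exists

end

/-! ### Smooth germs -/

section Germs

variable {A B C : Type*} [NormedAddCommGroup A] [NormedSpace ℝ A] [NormedAddCommGroup B]
  [NormedSpace ℝ B] [NormedAddCommGroup C] [NormedSpace ℝ C]

/-! Straighten each family. If `j` parametrizes a complement of the image of the `u`-derivative of
`g`, then `((u, w), t) ↦ (g (u, t) + j w, t)` is a diffeomorphism germ preserving time. It carries
the zero section `w = 0` to the graph of the family, and since the graph map is a homeomorphism onto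
its image, no other piece of the image comes near the base point
(`IsImmersedFamily.exists_straightening`). Contact thus becomes a question about diffeomorphism
germs that respect time and the zero section and match the zero sets of two submersions.

From contact to equivalence: `f₂ ∘ Φ` vanishes on the zero set of the submersion `f₁`, so Hadamard's
lemma gives `f₂ ∘ Φ = μ f₁`, and `μ` is a unit because `f₂ ∘ Φ` is again a submersion. Restriction
to the zero section yields the equivalence.

Conversely, extend `Ψ` by the identity of the fibre and extend the unit `l` constantly along it. The
extended functions `l · A` and `B ∘ Ψ'` agree on the zero section but perhaps not off it. They are
matched by sliding points along one fixed direction (`exists_isDiffeoGerm_comp_eq`). If `A` has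
nonzero derivative along some `u`-direction, sliding there leaves `w` and `t` alone. Otherwise both
derivatives vanish on the `u`-directions, so both submersions are detected by `w`-directions, and
one direction serves both; sliding along it fixes every point where the two functions agree, hence
the zero section.

A world sheet is such a family, and the tangent lightlike hyperplane is the zero set of a
nonconstant affine function whose composite with `X` is the extended height function. -/

theorem ContDiff.isSmoothGerm {f : A → B} (hf : ContDiff ℝ ∞ f) (a : A) : IsSmoothGerm f a :=
  Eventually.of_forall fun _ => hf.contDiffAt

namespace IsSmoothGerm

theorem contDiffAt {f : A → B} {a : A} (hf : IsSmoothGerm f a) : ContDiffAt ℝ ∞ f a :=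
  hf.self_of_nhds

theorem differentiableAt {f : A → B} {a : A} (hf : IsSmoothGerm f a) : DifferentiableAt ℝ f a :=
  hf.contDiffAt.differentiableAt (by simp)

theorem continuousAt {f : A → B} {a : A} (hf : IsSmoothGerm f a) : ContinuousAt f a :=
  hf.contDiffAt.continuousAt

theorem comp {g : B → C} {f : A → B} {a : A} (hg : IsSmoothGerm g (f a)) (hf : IsSmoothGerm f a) :
    IsSmoothGerm (g ∘ f) a := by
  filter_upwards [hf.continuousAt.eventually hg, hf] with x h1 h2 using h1.comp x h2

theorem prodMk {f : A → B} {g : A → C} {a : A} (hf : IsSmoothGerm f a) (hg : IsSmoothGerm g a) :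
    IsSmoothGerm (fun x => (f x, g x)) a := by
  filter_upwards [hf, hg] with x h1 h2 using h1.prodMk h2

theorem add {f g : A → B} {a : A} (hf : IsSmoothGerm f a) (hg : IsSmoothGerm g a) :
    IsSmoothGerm (fun x => f x + g x) a := by
  filter_upwards [hf, hg] with x h1 h2 using h1.add h2

theorem sub {f g : A → B} {a : A} (hf : IsSmoothGerm f a) (hg : IsSmoothGerm g a) :
    IsSmoothGerm (fun x => f x - g x) a := by
  filter_upwards [hf, hg] with x h1 h2 using h1.sub h2

theorem mul {f g : A → ℝ} {a : A} (hf : IsSmoothGerm f a) (hg : IsSmoothGerm g a) :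
    IsSmoothGerm (fun x => f x * g x) a := by
  filter_upwards [hf, hg] with x h1 h2 using h1.mul h2

theorem smul {f : A → ℝ} {g : A → B} {a : A} (hf : IsSmoothGerm f a) (hg : IsSmoothGerm g a) :
    IsSmoothGerm (fun x => f x • g x) a := by
  filter_upwards [hf, hg] with x h1 h2 using h1.smul h2

/-- A smooth germ in finite dimension is represented by a globally smooth map. -/
theorem exists_contDiff [FiniteDimensional ℝ A] {f : A → B} {a : A} (hf : IsSmoothGerm f a) :
    ∃ g : A → B, ContDiff ℝ ∞ g ∧ g =ᶠ[𝓝 a] f := by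
  obtain ⟨ε, hε, h⟩ := Metric.eventually_nhds_iff_ball.1 hf
  -- The support has radius `ε / 2 < ε`, so the product is locally zero at every point outside the
  -- ball on which `f` is smooth.
  let χ : ContDiffBump a := ⟨ε / 4, ε / 2, by positivity, by linarith⟩
  refine ⟨fun x => χ x • f x, contDiff_iff_contDiffAt.2 fun x => ?_, ?_⟩
  · by_cases hx : x ∈ Metric.ball a ε
    · exact χ.contDiffAt.smul (h x hx)
    · refine (contDiffAt_const (c := (0 : B))).congr_of_eventuallyEq ?_
      have hx' : x ∉ tsupport χ := by
        rw [χ.tsupport_eq]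
        intro hx'
        refine hx (Metric.mem_ball.2 ((Metric.mem_closedBall.1 hx').trans_lt ?_))
        change ε / 2 < ε
        linarith
      filter_upwards [(isClosed_tsupport χ).isOpen_compl.mem_nhds hx'] with y hy
      rw [image_eq_zero_of_notMem_tsupport hy, zero_smul]
  · filter_upwards [χ.eventuallyEq_one] with x hx
    rw [hx, Pi.one_apply, one_smul]

end IsSmoothGerm

theorem ContDiffOn.isSmoothGerm {f : A → B} {s : Set A} (hf : ContDiffOn ℝ ∞ f s) (hs : IsOpen s)
    {a : A} (ha : a ∈ s) : IsSmoothGerm f a := by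
  filter_upwards [hs.mem_nhds ha] with x hx using hf.contDiffAt (hs.mem_nhds hx)

/-! ### Germs of diffeomorphisms -/

/-- `Φ` represents a smooth diffeomorphism germ `(A, a) → (B, b)`. -/
structure IsDiffeoGerm (Φ : OpenPartialHomeomorph A B) (a : A) (b : B) : Prop where
  mem_source : a ∈ Φ.source
  map_base : Φ a = b
  smooth : ContDiffOn ℝ ∞ Φ Φ.source
  smooth_symm : ContDiffOn ℝ ∞ Φ.symm Φ.target

namespace IsDiffeoGerm

variable {Φ : OpenPartialHomeomorph A B} {a : A} {b : B}

theorem mem_target (h : IsDiffeoGerm Φ a b) : b ∈ Φ.target :=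
  h.map_base ▸ Φ.map_source h.mem_source

theorem symm_base (h : IsDiffeoGerm Φ a b) : Φ.symm b = a := by
  rw [← h.map_base, Φ.left_inv h.mem_source]

theorem symm (h : IsDiffeoGerm Φ a b) : IsDiffeoGerm Φ.symm b a :=
  ⟨h.mem_target, h.symm_base, h.smooth_symm, by simpa using h.smooth⟩

theorem trans {Θ : OpenPartialHomeomorph B C} {c : C} (h : IsDiffeoGerm Φ a b)
    (h' : IsDiffeoGerm Θ b c) : IsDiffeoGerm (Φ.trans Θ) a c where
  mem_source := by
    rw [Φ.trans_source]
    exact ⟨h.mem_source, by rw [mem_preimage, h.map_base]; exact h'.mem_source⟩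
  map_base := by simp [h.map_base, h'.map_base]
  smooth := by
    rw [Φ.trans_source]
    exact h'.smooth.comp (h.smooth.mono inter_subset_left) fun x hx => hx.2
  smooth_symm := by
    rw [Φ.trans_target]
    exact h.smooth_symm.comp (h'.smooth_symm.mono inter_subset_left) fun x hx => hx.2

theorem restrOpen (h : IsDiffeoGerm Φ a b) {s : Set A} (hs : IsOpen s) (ha : a ∈ s) :
    IsDiffeoGerm (Φ.restrOpen s hs) a b where
  mem_source := ⟨h.mem_source, ha⟩
  map_base := h.map_base
  smooth := h.smooth.mono inter_subset_left
  smooth_symm := h.smooth_symm.mono inter_subset_left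

theorem isSmoothGerm (h : IsDiffeoGerm Φ a b) : IsSmoothGerm Φ a :=
  h.smooth.isSmoothGerm Φ.open_source h.mem_source

theorem tendsto (h : IsDiffeoGerm Φ a b) : Tendsto Φ (𝓝 a) (𝓝 b) := by
  have := h.isSmoothGerm.continuousAt
  rwa [ContinuousAt, h.map_base] at this

theorem eventually_source (h : IsDiffeoGerm Φ a b) : ∀ᶠ x in 𝓝 a, x ∈ Φ.source :=
  Φ.open_source.mem_nhds h.mem_source

theorem fderiv_symm_comp (h : IsDiffeoGerm Φ a b) :
    (fderiv ℝ Φ.symm b).comp (fderiv ℝ Φ a) = ContinuousLinearMap.id ℝ A := by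
  have h1 : HasFDerivAt Φ.symm (fderiv ℝ Φ.symm b) (Φ a) := by
    rw [h.map_base]; exact h.symm.isSmoothGerm.differentiableAt.hasFDerivAt
  have h2 := h1.comp a h.isSmoothGerm.differentiableAt.hasFDerivAt
  refine h2.unique ((hasFDerivAt_id a).congr_of_eventuallyEq ?_)
  filter_upwards [h.eventually_source] with x hx
  exact Φ.left_inv hx

theorem bijective_fderiv (h : IsDiffeoGerm Φ a b) : Function.Bijective (fderiv ℝ Φ a) := by
  have h1 := h.fderiv_symm_comp
  have h2 := h.symm.fderiv_symm_comp
  rw [OpenPartialHomeomorph.symm_symm] at h2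
  exact Function.bijective_iff_has_inverse.2 ⟨fderiv ℝ Φ.symm b,
    fun x => DFunLike.congr_fun h1 x, fun x => DFunLike.congr_fun h2 x⟩

end IsDiffeoGerm

/-- Inverse function theorem for smooth germs. -/
theorem IsSmoothGerm.exists_isDiffeoGerm [FiniteDimensional ℝ A] [FiniteDimensional ℝ B]
    {f : A → B} {a : A} (hf : IsSmoothGerm f a)
    (hinj : Function.Injective (fderiv ℝ f a))
    (hdim : Module.finrank ℝ A = Module.finrank ℝ B) :
    ∃ Φ : OpenPartialHomeomorph A B, IsDiffeoGerm Φ a (f a) ∧ (Φ : A → B) = f := by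
  have : CompleteSpace A := FiniteDimensional.complete ℝ A
  let L : A ≃L[ℝ] B :=
    (LinearEquiv.ofInjectiveOfFinrankEq (fderiv ℝ f a).toLinearMap hinj hdim).toContinuousLinearEquiv
  have hL : (L : A →L[ℝ] B) = fderiv ℝ f a := by
    ext x; rfl
  have hL' : HasFDerivAt f (L : A →L[ℝ] B) a := hL ▸ hf.differentiableAt.hasFDerivAt
  let Θ := hf.contDiffAt.toOpenPartialHomeomorph f hL' (by simp)
  have hΘ : (Θ : A → B) = f := rfl
  have haΘ : a ∈ Θ.source := hf.contDiffAt.mem_toOpenPartialHomeomorph_source hL' (by simp)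
  -- Smoothness of the inverse on the whole target needs an invertible derivative at every source
  -- point; invertibility is an open condition, so shrinking the source suffices.
  have hinv : ∀ᶠ x in 𝓝 a, ∃ e : A ≃L[ℝ] B, (e : A →L[ℝ] B) = fderiv ℝ f x := by
    have hc : ContinuousAt (fderiv ℝ f) a :=
      (hf.contDiffAt.fderiv_right (m := 0) (by simp)).continuousAt
    have := hc.eventually (hL ▸ ContinuousLinearEquiv.nhds L)
    exact this
  obtain ⟨s, hs, hso, has⟩ := eventually_nhds_iff.1 (hf.and hinv)
  refine ⟨Θ.restrOpen s hso, ⟨⟨haΘ, has⟩, rfl, fun x hx => ?_, fun y hy => ?_⟩, rfl⟩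
  · exact (hs x hx.2).1.contDiffWithinAt
  · obtain ⟨hy1, hy2⟩ := hy
    obtain ⟨h1, e, he⟩ := hs _ hy2
    refine (Θ.contDiffAt_symm (f₀' := e) hy1 ?_ h1).contDiffWithinAt
    rw [he]
    exact (h1.differentiableAt (by simp)).hasFDerivAt

/-- If `F` is smooth with nonzero derivative along `e`, then `F` can be made a coordinate by a change
of coordinates along `e`. -/
theorem IsSmoothGerm.exists_shear [FiniteDimensional ℝ A] {F : A → ℝ} {a e : A} {l : A →L[ℝ] ℝ}
    (hF : IsSmoothGerm F a) (hl : l e = 1) (he : fderiv ℝ F a e ≠ 0) :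
    ∃ Φ : OpenPartialHomeomorph A A, IsDiffeoGerm Φ a (a + (F a - l a) • e) ∧
      ∀ z, Φ z = z + (F z - l z) • e := by
  have hs : IsSmoothGerm (fun z => z + (F z - l z) • e) a :=
    (contDiff_id.isSmoothGerm a).add
      ((hF.sub (l.contDiff.isSmoothGerm a)).smul (contDiff_const.isSmoothGerm a))
  have hd : HasFDerivAt (fun z => z + (F z - l z) • e)
      (ContinuousLinearMap.id ℝ A + (fderiv ℝ F a - l).smulRight e) a :=
    (hasFDerivAt_id a).add
      ((hF.differentiableAt.hasFDerivAt.sub l.hasFDerivAt).smul_const e)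
  obtain ⟨Φ, h1, h2⟩ := hs.exists_isDiffeoGerm (by
    rw [hd.fderiv]
    refine (injective_iff_map_eq_zero _).2 fun x hx => ?_
    have hx' : x + (fderiv ℝ F a x - l x) • e = 0 := hx
    -- A kernel vector lies on the line of `e`; applying `l` then leaves `c` times the derivative of
    -- `F` along `e`.
    obtain ⟨c, rfl⟩ : ∃ c : ℝ, x = c • e := ⟨-(fderiv ℝ F a x - l x), by
      rw [neg_smul]; exact eq_neg_of_add_eq_zero_left hx'⟩
    have h3 := congrArg l hx'
    simp only [map_add, map_smul, hl, smul_eq_mul, map_zero, mul_one] at h3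
    have h4 : c * fderiv ℝ F a e = 0 := by linarith
    rw [(mul_eq_zero.1 h4).resolve_right he, zero_smul]) rfl
  exact ⟨Φ, h1, fun z => by rw [h2]⟩

end Germs

/-! ### Hadamard's lemma -/

section Hadamard

open MeasureTheory

variable {A : Type*} [NormedAddCommGroup A] [NormedSpace ℝ A]

/-- The integral is the value at `0` of the convolution of the indicator of `[0, 1]` with `r ↦ χ r *
k (x, -r)`, where the bump `χ` is `1` on `[-1, 1]`; convolutions with compact support depend
smoothly on parameters. -/
theorem ContDiff.integral_Icc {k : A × ℝ → ℝ} (hk : ContDiff ℝ ∞ k) :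
    ContDiff ℝ ∞ fun x => ∫ r in (0 : ℝ)..1, k (x, r) := by
  let χ : ContDiffBump (0 : ℝ) := ⟨1, 2, one_pos, one_lt_two⟩
  have h := contDiffOn_convolution_right_with_param (μ := (volume : Measure ℝ)) (n := ⊤)
    (f := (Icc (0 : ℝ) 1).indicator fun _ => (1 : ℝ)) (ContinuousLinearMap.mul ℝ ℝ)
    (g := fun (p : A) (x : ℝ) => χ x * k (p, -x)) (s := univ) (k := tsupport χ) isOpen_univ
    χ.hasCompactSupport (fun p x _ hx => by
      simp only [image_eq_zero_of_notMem_tsupport hx, zero_mul])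
    ((integrable_indicator_iff measurableSet_Icc).2 (by simp)).locallyIntegrable
    (ContDiff.contDiffOn (by
      change ContDiff ℝ ∞ fun q : A × ℝ => χ q.2 * k (q.1, -q.2)
      exact (χ.contDiff.comp contDiff_snd).mul
        (hk.comp (contDiff_fst.prodMk contDiff_snd.neg))))
  rw [univ_prod_univ, contDiffOn_univ] at h
  convert h.comp (contDiff_id.prodMk (contDiff_const (c := (0 : ℝ)))) using 1
  funext x
  rw [intervalIntegral.integral_of_le zero_le_one, ← integral_Icc_eq_integral_Ioc]
  simp only [Function.comp_apply, convolution, id, ContinuousLinearMap.mul_apply', zero_sub,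
    neg_neg]
  rw [← integral_indicator measurableSet_Icc]
  congr 1
  funext r
  by_cases hr : r ∈ Icc (0 : ℝ) 1
  · have : χ (-r) = 1 := χ.one_of_mem_closedBall (by
      change -r ∈ Metric.closedBall (0 : ℝ) 1
      rw [mem_closedBall_zero_iff, norm_neg, Real.norm_eq_abs, abs_le]
      exact ⟨by linarith [hr.1], hr.2⟩)
    simp [hr, this]
  · simp [hr]

/-- Hadamard's lemma in linear coordinates: a smooth function vanishing on the hyperplane `l = 0`
near `b` is divisible by `l`. -/
theorem IsSmoothGerm.exists_eq_mul_linear [FiniteDimensional ℝ A] {H : A → ℝ} {b e : A}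
    {l : A →L[ℝ] ℝ} (hH : IsSmoothGerm H b) (hl : l e = 1) (hb : l b = 0)
    (hz : ∀ᶠ y in 𝓝 b, l y = 0 → H y = 0) :
    ∃ μ : A → ℝ, ContDiff ℝ ∞ μ ∧ ∀ᶠ y in 𝓝 b, H y = μ y * l y := by
  obtain ⟨G, hG, hGH⟩ := hH.exists_contDiff
  -- The segment from the projection of `y` along `e` to the hyperplane `l = 0` (at `r = 0`) to `y`
  -- itself (at `r = 1`). Its velocity is `l y • e`, so integrating the derivative of `G` produces
  -- the factor `l y`.
  let σ : A × ℝ → A := fun p => p.1 - ((1 - p.2) * l p.1) • e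
  have hσ : ContDiff ℝ ∞ σ :=
    contDiff_fst.sub (((contDiff_const.sub contDiff_snd).mul (l.contDiff.comp contDiff_fst)).smul
      contDiff_const)
  have hk : ContDiff ℝ ∞ fun p => fderiv ℝ G (σ p) e :=
    ((hG.fderiv_right (m := ∞) (by simp)).comp hσ).clm_apply contDiff_const
  refine ⟨_, ContDiff.integral_Icc hk, ?_⟩
  have hproj : Tendsto (fun y => σ (y, 0)) (𝓝 b) (𝓝 b) := by
    have h : Continuous fun y => σ (y, 0) := hσ.continuous.comp (by fun_prop)
    have h' := h.tendsto b
    have h0 : σ (b, 0) = b := by simp [σ, hb]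
    rwa [h0] at h'
  filter_upwards [hGH, hproj.eventually hGH, hproj.eventually hz] with y h1 h2 h3
  have hl0 : l (σ (y, 0)) = 0 := by simp [σ, hl]
  have hG0 : G (σ (y, 0)) = 0 := h2.trans (h3 hl0)
  have hG1 : G (σ (y, 1)) = H y := by simpa [σ] using h1
  have hder : ∀ r : ℝ, HasDerivAt (fun r => G (σ (y, r))) (fderiv ℝ G (σ (y, r)) e * l y) r := by
    intro r
    have h4 : HasDerivAt (fun r : ℝ => σ (y, r)) (l y • e) r := by
      have h5 : HasDerivAt (fun r : ℝ => (1 - r) * l y) (-1 * l y) r :=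
        ((hasDerivAt_id r).const_sub 1).mul_const _
      have h6 := (h5.smul_const e).const_sub y
      simpa [σ] using h6
    have h7 := (hG.differentiable (by simp) (σ (y, r))).hasFDerivAt.comp_hasDerivAt r h4
    rw [map_smul, smul_eq_mul, mul_comm] at h7
    exact h7
  have hint := intervalIntegral.integral_eq_sub_of_hasDerivAt (a := 0) (b := 1)
    (fun r _ => hder r) (Continuous.intervalIntegrable
      ((hk.continuous.comp (by fun_prop : Continuous fun r : ℝ => (y, r))).mul
        continuous_const) _ _)
  rw [hG0, hG1, sub_zero] at hint
  rw [← hint, intervalIntegral.integral_mul_const]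

/-- Hadamard's lemma: a smooth function vanishing on the zero set of a submersion `F` is divisible
by `F`. -/
theorem IsSmoothGerm.exists_eq_mul [FiniteDimensional ℝ A] {F G : A → ℝ} {a : A}
    (hF : IsSmoothGerm F a) (hG : IsSmoothGerm G a) (hFa : F a = 0) (hdF : fderiv ℝ F a ≠ 0)
    (hz : ∀ᶠ z in 𝓝 a, F z = 0 → G z = 0) :
    ∃ μ : A → ℝ, IsSmoothGerm μ a ∧ ∀ᶠ z in 𝓝 a, G z = μ z * F z := by
  obtain ⟨e, he⟩ : ∃ e, fderiv ℝ F a e ≠ 0 := by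
    by_contra! h
    exact hdF (ContinuousLinearMap.ext h)
  have he0 : e ≠ 0 := fun h => he (by rw [h, map_zero])
  obtain ⟨l, hl⟩ := SeparatingDual.exists_eq_one (R := ℝ) he0
  obtain ⟨Φ, hΦ, hΦe⟩ := hF.exists_shear hl he
  have hlΦ : ∀ z, l (Φ z) = F z := fun z => by rw [hΦe]; simp [hl]
  have hGs : IsSmoothGerm (G ∘ Φ.symm) (a + (F a - l a) • e) :=
    IsSmoothGerm.comp (by rwa [hΦ.symm_base]) hΦ.symm.isSmoothGerm
  obtain ⟨μ, hμ, hμG⟩ := hGs.exists_eq_mul_linear hl (by rw [← hΦ.map_base, hlΦ, hFa]) (by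
    filter_upwards [hΦ.symm.tendsto.eventually hz, hΦ.symm.eventually_source] with y h1 h2 h3
    refine h1 ?_
    rw [← hlΦ, Φ.right_inv h2, h3])
  refine ⟨μ ∘ Φ, (hμ.isSmoothGerm _).comp hΦ.isSmoothGerm, ?_⟩
  filter_upwards [hΦ.tendsto.eventually hμG, hΦ.eventually_source] with z h1 h2
  rw [Function.comp_apply, Φ.left_inv h2, hlΦ] at h1
  exact h1

end Hadamard

theorem isParamDiffeoGerm_iff {E : Type*} [NormedAddCommGroup E] [NormedSpace ℝ E]
    {Φ : OpenPartialHomeomorph (E × ℝ) (E × ℝ)} {a b : E × ℝ} :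
    IsParamDiffeoGerm Φ a b ↔
      IsDiffeoGerm Φ a b ∧ ∃ φ₂ : ℝ → ℝ, ∀ z ∈ Φ.source, (Φ z).2 = φ₂ z.2 :=
  ⟨fun h => ⟨⟨h.mem_source, h.map_base, h.smooth, h.smooth_symm⟩, h.time⟩,
    fun h => ⟨h.1.mem_source, h.1.map_base, h.1.smooth, h.1.smooth_symm, h.2⟩⟩

/-! ### The zero section of `(E × W) × ℝ → E × ℝ` -/

section ZeroSection

variable {E W : Type*} [NormedAddCommGroup E] [NormedSpace ℝ E] [NormedAddCommGroup W]
  [NormedSpace ℝ W]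

/-- The inclusion `(u, t) ↦ ((u, 0), t)`. -/
noncomputable def zeroSection (W : Type*) [NormedAddCommGroup W] [NormedSpace ℝ W] :
    E × ℝ →L[ℝ] (E × W) × ℝ :=
  ((ContinuousLinearMap.inl ℝ E W).comp (ContinuousLinearMap.fst ℝ E ℝ)).prod
    (ContinuousLinearMap.snd ℝ E ℝ)

/-- The projection `((u, w), t) ↦ (u, t)`. -/
noncomputable def dropFiber (W : Type*) [NormedAddCommGroup W] [NormedSpace ℝ W] :
    (E × W) × ℝ →L[ℝ] E × ℝ :=
  ((ContinuousLinearMap.fst ℝ E W).comp (ContinuousLinearMap.fst ℝ (E × W) ℝ)).prod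
    (ContinuousLinearMap.snd ℝ (E × W) ℝ)

theorem zeroSection_apply (q : E × ℝ) : zeroSection W q = ((q.1, 0), q.2) := rfl

theorem dropFiber_apply (z : (E × W) × ℝ) : dropFiber W z = (z.1.1, z.2) := rfl

theorem zeroSection_dropFiber {z : (E × W) × ℝ} (hz : z.1.2 = 0) :
    zeroSection W (dropFiber W z) = z := by
  obtain ⟨⟨u, w⟩, t⟩ := z
  obtain rfl : w = 0 := hz
  rfl

theorem dropFiber_zeroSection (q : E × ℝ) : dropFiber W (zeroSection W q) = q := rfl

theorem tendsto_zeroSection (q : E × ℝ) :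
    Tendsto (zeroSection W) (𝓝 q) (𝓝 (zeroSection W q)) :=
  (zeroSection W).continuous.tendsto q

theorem tendsto_dropFiber (q : E × ℝ) :
    Tendsto (dropFiber W) (𝓝 (zeroSection W q)) (𝓝 q) :=
  (dropFiber W).continuous.tendsto (zeroSection W q)

/-- A diffeomorphism germ preserving the zero section restricts to the zero section. -/
theorem IsDiffeoGerm.exists_restrict {Ω : OpenPartialHomeomorph ((E × W) × ℝ) ((E × W) × ℝ)}
    {q₁ q₂ : E × ℝ} (h : IsDiffeoGerm Ω (zeroSection W q₁) (zeroSection W q₂))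
    (hz : ∀ᶠ z in 𝓝 (zeroSection W q₁), z.1.2 = 0 ↔ (Ω z).1.2 = 0) :
    ∃ Ψ : OpenPartialHomeomorph (E × ℝ) (E × ℝ), IsDiffeoGerm Ψ q₁ q₂ ∧
      ∀ q ∈ Ψ.source, zeroSection W q ∈ Ω.source ∧ zeroSection W (Ψ q) = Ω (zeroSection W q) := by
  obtain ⟨s, hs, hso, hqs⟩ := eventually_nhds_iff.1 hz
  -- On the shrunken source the equivalence holds at every point: one implication lets the map
  -- restrict to the zero section, the other its inverse.
  have hR := h.restrOpen hso hqs
  obtain ⟨R, hRdef⟩ : ∃ R, R = Ω.restrOpen s hso := ⟨_, rfl⟩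
  rw [← hRdef] at hR
  have hRΩ : (R : (E × W) × ℝ → (E × W) × ℝ) = Ω := by rw [hRdef]; rfl
  have hRs : ∀ z ∈ R.source, z ∈ Ω.source ∧ z ∈ s := fun z hzR => by rw [hRdef] at hzR; exact hzR
  have hto : ∀ q, zeroSection W q ∈ R.source →
      zeroSection W (dropFiber W (R (zeroSection W q))) = R (zeroSection W q) := fun q hq =>
    zeroSection_dropFiber (by rw [hRΩ]; exact (hs _ (hRs _ hq).2).1 rfl)
  have hinv : ∀ q, zeroSection W q ∈ R.target →
      zeroSection W (dropFiber W (R.symm (zeroSection W q))) = R.symm (zeroSection W q) := by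
    intro q hq
    refine zeroSection_dropFiber ((hs _ (hRs _ (R.map_target hq)).2).2 ?_)
    rw [← hRΩ, R.right_inv hq]; rfl
  let Ψ : OpenPartialHomeomorph (E × ℝ) (E × ℝ) :=
    { toFun := fun q => dropFiber W (R (zeroSection W q))
      invFun := fun q => dropFiber W (R.symm (zeroSection W q))
      source := zeroSection W ⁻¹' R.source
      target := zeroSection W ⁻¹' R.target
      map_source' := fun q hq => by
        rw [mem_preimage, hto q hq]; exact R.map_source hq
      map_target' := fun q hq => by
        rw [mem_preimage, hinv q hq]; exact R.map_target hq
      left_inv' := fun q hq => by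
        rw [hto q hq, R.left_inv hq, dropFiber_zeroSection]
      right_inv' := fun q hq => by
        rw [hinv q hq, R.right_inv hq, dropFiber_zeroSection]
      open_source := R.open_source.preimage (zeroSection W).continuous
      open_target := R.open_target.preimage (zeroSection W).continuous
      continuousOn_toFun := (dropFiber W).continuous.comp_continuousOn
        (R.continuousOn.comp (zeroSection W).continuous.continuousOn fun q hq => hq)
      continuousOn_invFun := (dropFiber W).continuous.comp_continuousOn
        (R.continuousOn_symm.comp (zeroSection W).continuous.continuousOn fun q hq => hq) }
  refine ⟨Ψ, ⟨hR.mem_source, ?_, ?_, ?_⟩, fun q hq => ⟨(hRs _ hq).1, ?_⟩⟩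
  · change dropFiber W (R (zeroSection W q₁)) = q₂
    rw [hR.map_base, dropFiber_zeroSection]
  · exact (dropFiber W).contDiff.comp_contDiffOn
      (hR.smooth.comp (zeroSection W).contDiff.contDiffOn fun q hq => hq)
  · exact (dropFiber W).contDiff.comp_contDiffOn
      (hR.smooth_symm.comp (zeroSection W).contDiff.contDiffOn fun q hq => hq)
  · rw [← hRΩ]; exact hto q hq

/-- A diffeomorphism germ of `E × ℝ` extends to `(E × W) × ℝ` by the identity of `W`. -/
theorem IsDiffeoGerm.exists_extend {Ψ : OpenPartialHomeomorph (E × ℝ) (E × ℝ)} {q₁ q₂ : E × ℝ}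
    (h : IsDiffeoGerm Ψ q₁ q₂) :
    ∃ Ω : OpenPartialHomeomorph ((E × W) × ℝ) ((E × W) × ℝ),
      IsDiffeoGerm Ω (zeroSection W q₁) (zeroSection W q₂) ∧
      (∀ z ∈ Ω.source, dropFiber W z ∈ Ψ.source) ∧
      ∀ z, Ω z = (((Ψ (dropFiber W z)).1, z.1.2), (Ψ (dropFiber W z)).2) := by
  let J : (E × ℝ) × W → (E × W) × ℝ := fun p => ((p.1.1, p.2), p.1.2)
  have hJ : ContDiff ℝ ∞ J :=
    ((contDiff_fst.comp contDiff_fst).prodMk contDiff_snd).prodMk (contDiff_snd.comp contDiff_fst)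
  have hfib : ContDiff ℝ ∞ fun z : (E × W) × ℝ => z.1.2 := contDiff_snd.comp contDiff_fst
  have hsm : ContDiffOn ℝ ∞ (fun z => J (Ψ (dropFiber W z), z.1.2)) (dropFiber W ⁻¹' Ψ.source) :=
    hJ.comp_contDiffOn ((h.smooth.comp (dropFiber (E := E) W).contDiff.contDiffOn
      (mapsTo_preimage _ _)).prodMk hfib.contDiffOn)
  have hsm' : ContDiffOn ℝ ∞ (fun z => J (Ψ.symm (dropFiber W z), z.1.2))
      (dropFiber W ⁻¹' Ψ.target) :=
    hJ.comp_contDiffOn ((h.smooth_symm.comp (dropFiber (E := E) W).contDiff.contDiffOn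
      (mapsTo_preimage _ _)).prodMk hfib.contDiffOn)
  let Ω : OpenPartialHomeomorph ((E × W) × ℝ) ((E × W) × ℝ) :=
    { toFun := fun z => J (Ψ (dropFiber W z), z.1.2)
      invFun := fun z => J (Ψ.symm (dropFiber W z), z.1.2)
      source := dropFiber W ⁻¹' Ψ.source
      target := dropFiber W ⁻¹' Ψ.target
      map_source' := fun z hz => Ψ.map_source hz
      map_target' := fun z hz => Ψ.map_target hz
      left_inv' := fun z hz => by
        change J (Ψ.symm (Ψ (dropFiber W z)), z.1.2) = z
        rw [Ψ.left_inv hz]; rfl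
      right_inv' := fun z hz => by
        change J (Ψ (Ψ.symm (dropFiber W z)), z.1.2) = z
        rw [Ψ.right_inv hz]; rfl
      open_source := Ψ.open_source.preimage (dropFiber W).continuous
      open_target := Ψ.open_target.preimage (dropFiber W).continuous
      continuousOn_toFun := hsm.continuousOn
      continuousOn_invFun := hsm'.continuousOn }
  refine ⟨Ω, ⟨h.mem_source, ?_, hsm, hsm'⟩, fun z hz => hz, fun z => rfl⟩
  change J (Ψ q₁, 0) = _
  rw [h.map_base]; rfl

theorem fderiv_zeroSection_comp {F : (E × W) × ℝ → ℝ} {q : E × ℝ}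
    (hF : IsSmoothGerm F (zeroSection W q)) (p : E × ℝ) :
    fderiv ℝ (F ∘ zeroSection W) q p = fderiv ℝ F (zeroSection W q) (zeroSection W p) := by
  rw [(hF.differentiableAt.hasFDerivAt.comp q (zeroSection (E := E) W).hasFDerivAt).fderiv]
  rfl

end ZeroSection

/-! ### Comparing two functions with the same restriction to the zero section -/

section Comparison

variable {A : Type*} [NormedAddCommGroup A] [NormedSpace ℝ A] [FiniteDimensional ℝ A]

/-- The shears `S` and `T` along `e` turn `F` and `G` into the same linear coordinate `l`, so `Θ =
T⁻¹ ∘ S` carries one to the other and moves points along `e`. Where `F = G` the shears coincide,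
which makes `Θ` the identity there. -/
theorem exists_isDiffeoGerm_comp_eq {F G : A → ℝ} {a e : A} (hF : IsSmoothGerm F a)
    (hG : IsSmoothGerm G a) (hFG : F a = G a) (hFe : fderiv ℝ F a e ≠ 0)
    (hGe : fderiv ℝ G a e ≠ 0) :
    ∃ Θ : OpenPartialHomeomorph A A, IsDiffeoGerm Θ a a ∧
      (∀ z ∈ Θ.source, (∃ c : ℝ, Θ z = z + c • e) ∧ G (Θ z) = F z) ∧
      ∀ᶠ z in 𝓝 a, (F z = G z → Θ z = z) ∧ (F (Θ z) = G (Θ z) → Θ z = z) := by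
  have he0 : e ≠ 0 := fun h => hFe (by rw [h, map_zero])
  obtain ⟨l, hl⟩ := SeparatingDual.exists_eq_one (R := ℝ) he0
  obtain ⟨S, hS, hSe⟩ := hF.exists_shear hl hFe
  obtain ⟨T, hT, hTe⟩ := hG.exists_shear hl hGe
  rw [← hFG] at hT
  have hST := hS.trans hT.symm
  have hTθ : ∀ z ∈ (S.trans T.symm).source, T (S.trans T.symm z) = S z := fun z hz => by
    rw [S.trans_source] at hz
    exact T.right_inv hz.2
  have heq : ∀ z, F z = G z → S z = T z := fun z hz => by rw [hSe, hTe, hz]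
  refine ⟨S.trans T.symm, hST, fun z hz => ?_, ?_⟩
  · have h1 := hTθ z hz
    generalize S.trans T.symm z = w at h1
    rw [hSe, hTe] at h1
    refine ⟨⟨(F z - l z) - (G w - l w), ?_⟩, ?_⟩
    · rw [sub_smul, ← add_sub_assoc, ← h1, add_sub_cancel_right]
    · simpa [hl] using congrArg l h1
  · filter_upwards [hST.eventually_source, hT.eventually_source, hS.eventually_source,
      hST.tendsto.eventually hS.eventually_source] with z h1 h2 h3 h4
    refine ⟨fun h => ?_, fun h => ?_⟩
    · change T.symm (S z) = z
      rw [heq z h, T.left_inv h2]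
    · have h5 := hTθ z h1
      rw [← heq _ h] at h5
      exact S.injOn h4 h3 h5

variable {E W : Type*} [NormedAddCommGroup E] [NormedSpace ℝ E] [NormedAddCommGroup W]
  [NormedSpace ℝ W] [FiniteDimensional ℝ E] [FiniteDimensional ℝ W]

/-- Two functions that agree on the zero section are right equivalent by a diffeomorphism germ that
preserves the zero section and the time. -/
theorem exists_isDiffeoGerm_preserving_zeroSection {F G : (E × W) × ℝ → ℝ} {q : E × ℝ}
    (hF : IsSmoothGerm F (zeroSection W q)) (hG : IsSmoothGerm G (zeroSection W q))
    (hFG : F ∘ zeroSection W =ᶠ[𝓝 q] G ∘ zeroSection W)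
    (hd : (∃ e : E, fderiv ℝ F (zeroSection W q) ((e, 0), 0) ≠ 0) ∨
      ∃ e : W, fderiv ℝ F (zeroSection W q) ((0, e), 0) ≠ 0 ∧
        fderiv ℝ G (zeroSection W q) ((0, e), 0) ≠ 0) :
    ∃ Θ : OpenPartialHomeomorph ((E × W) × ℝ) ((E × W) × ℝ),
      IsDiffeoGerm Θ (zeroSection W q) (zeroSection W q) ∧
      (∀ z ∈ Θ.source, (Θ z).2 = z.2 ∧ G (Θ z) = F z) ∧
      ∀ᶠ z in 𝓝 (zeroSection W q), z.1.2 = 0 ↔ (Θ z).1.2 = 0 := by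
  rcases hd with ⟨e, he⟩ | ⟨e, heF, heG⟩
  -- The direction `e` is tangent to the zero section, where the functions agree, so their
  -- derivatives along it agree too.
  · have heG : fderiv ℝ G (zeroSection W q) ((e, 0), 0) ≠ 0 := by
      have h1 := fderiv_zeroSection_comp hF (e, 0)
      have h2 := fderiv_zeroSection_comp hG (e, 0)
      rw [← hFG.fderiv_eq, h1] at h2
      exact fun h => he (h2.trans h)
    obtain ⟨Θ, hΘ, h1, -⟩ := exists_isDiffeoGerm_comp_eq hF hG hFG.self_of_nhds he heG
    refine ⟨Θ, hΘ, fun z hz => ⟨?_, (h1 z hz).2⟩, ?_⟩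
    · obtain ⟨⟨c, hc⟩, -⟩ := h1 z hz
      simp [hc]
    · filter_upwards [hΘ.eventually_source] with z hz
      obtain ⟨⟨c, hc⟩, -⟩ := h1 z hz
      simp [hc]
  -- Subtracting `F ∘ P` normalizes both functions to vanish on the zero section. As `F ∘ P` is
  -- constant along the fibre direction `e`, matching the differences along `e` also matches `F` and
  -- `G`.
  · let P : (E × W) × ℝ →L[ℝ] (E × W) × ℝ := (zeroSection W).comp (dropFiber W)
    have hPa : P (zeroSection W q) = zeroSection W q := rfl
    have hPs : IsSmoothGerm (F ∘ P) (zeroSection W q) :=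
      IsSmoothGerm.comp (by rwa [hPa]) (P.contDiff.isSmoothGerm _)
    have hPd : fderiv ℝ (F ∘ P) (zeroSection W q) ((0, e), 0) = 0 := by
      have h1 : HasFDerivAt F (fderiv ℝ F (zeroSection W q)) (P (zeroSection W q)) :=
        hF.differentiableAt.hasFDerivAt
      rw [(h1.comp _ P.hasFDerivAt).fderiv]
      exact map_zero (fderiv ℝ F (zeroSection W q))
    have hsub : ∀ K : (E × W) × ℝ → ℝ, IsSmoothGerm K (zeroSection W q) →
        fderiv ℝ (fun z => K z - (F ∘ P) z) (zeroSection W q) ((0, e), 0) =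
          fderiv ℝ K (zeroSection W q) ((0, e), 0) := fun K hK => by
      rw [fderiv_fun_sub hK.differentiableAt hPs.differentiableAt, sub_apply, hPd,
        sub_zero]
    have hPz : ∀ (z : (E × W) × ℝ) (c : ℝ), P (z + c • ((0, e), 0)) = P z := fun z c => by
      rw [map_add, map_smul]
      have : P ((0, e), 0) = 0 := rfl
      rw [this, smul_zero, add_zero]
    obtain ⟨Θ, hΘ, h1, h2⟩ := exists_isDiffeoGerm_comp_eq (hF.sub hPs) (hG.sub hPs)
      (by rw [show F (zeroSection W q) = G (zeroSection W q) from hFG.self_of_nhds])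
      (by rwa [hsub F hF]) (by rwa [hsub G hG])
    have hFG' : ∀ᶠ z in 𝓝 (zeroSection W q), z.1.2 = 0 → F z = G z := by
      filter_upwards [(tendsto_dropFiber (W := W) q).eventually hFG] with z hz hz0
      rw [← zeroSection_dropFiber hz0]; exact hz
    refine ⟨Θ, hΘ, fun z hz => ?_, ?_⟩
    · obtain ⟨⟨c, hc⟩, h3⟩ := h1 z hz
      have h4 : (F ∘ P) (Θ z) = (F ∘ P) z := by
        rw [hc, Function.comp_apply, hPz]; rfl
      exact ⟨by simp [hc], by rw [h4] at h3; linarith⟩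
    · filter_upwards [h2, hFG', hΘ.tendsto.eventually hFG'] with z h3 h4 h5
      refine ⟨fun h => ?_, fun h => ?_⟩
      · rw [h3.1 (by rw [h4 h]), h]
      · rw [← h3.2 (by rw [h5 h])]; exact h

end Comparison

/-- A vector space is not the union of two proper subspaces. -/
theorem exists_ne_zero_and_ne_zero {W : Type*} [AddCommGroup W] [Module ℝ W] (α β : W →ₗ[ℝ] ℝ)
    (hα : α ≠ 0) (hβ : β ≠ 0) : ∃ e, α e ≠ 0 ∧ β e ≠ 0 := by
  obtain ⟨x, hx⟩ := DFunLike.ne_iff.1 hα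
  obtain ⟨y, hy⟩ := DFunLike.ne_iff.1 hβ
  rw [LinearMap.zero_apply] at hx hy
  by_cases h1 : β x = 0
  · by_cases h2 : α y = 0
    · exact ⟨x + y, by simpa [h2], by simpa [h1]⟩
    · exact ⟨y, h2, hy⟩
  · exact ⟨x, hx, h1⟩

/-! ### Straightening a family of immersions -/

/-- The map `j` identifies the coordinate space with a complement of the range of `D`; `s ≤ m` keeps
the subtraction `m - s` from truncating. -/
theorem LinearMap.exists_complement_injective {s m : ℕ} (D : (Fin s → ℝ) →ₗ[ℝ] (Fin m → ℝ))
    (hD : Function.Injective D) :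
    s ≤ m ∧ ∃ j : (Fin (m - s) → ℝ) →ₗ[ℝ] (Fin m → ℝ), ∀ u w, D u + j w = 0 → u = 0 ∧ w = 0 := by
  have hsm : s ≤ m := by simpa using LinearMap.finrank_le_finrank_of_injective hD
  obtain ⟨C, hC⟩ := Submodule.exists_isCompl (LinearMap.range D)
  have hr : Module.finrank ℝ (LinearMap.range D) = s := by
    simpa using LinearMap.finrank_range_of_inj hD
  have hdim : Module.finrank ℝ (Fin (m - s) → ℝ) = Module.finrank ℝ C := by
    have h := Submodule.finrank_add_eq_of_isCompl hC
    rw [hr] at h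
    simp only [Module.finrank_fin_fun] at h ⊢
    omega
  let L := LinearEquiv.ofFinrankEq (Fin (m - s) → ℝ) C hdim
  refine ⟨hsm, C.subtype ∘ₗ L.toLinearMap, fun u w h => ?_⟩
  have h1 : D u ∈ LinearMap.range D ⊓ C := by
    refine ⟨⟨u, rfl⟩, ?_⟩
    rw [eq_neg_of_add_eq_zero_left h]
    exact C.neg_mem (L w).2
  rw [hC.inf_eq_bot, Submodule.mem_bot] at h1
  refine ⟨hD (h1.trans (map_zero D).symm), ?_⟩
  rw [h1, zero_add] at h
  exact (map_eq_zero_iff L L.injective).1 (Subtype.ext h)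

/-- The derivative preserves the time component, so a kernel vector has `t = 0` and `hj` kills the
rest; equality of dimensions then permits the inverse function theorem. -/
theorem IsSmoothGerm.exists_isDiffeoGerm_add_fiber {E W V : Type*} [NormedAddCommGroup E]
    [NormedSpace ℝ E] [FiniteDimensional ℝ E] [NormedAddCommGroup W] [NormedSpace ℝ W]
    [FiniteDimensional ℝ W] [NormedAddCommGroup V] [NormedSpace ℝ V] [FiniteDimensional ℝ V]
    {g : E × ℝ → V} {q : E × ℝ} (hg : IsSmoothGerm g q) (j : W →L[ℝ] V)
    (hj : ∀ u w, fderiv ℝ g q (u, 0) + j w = 0 → u = 0 ∧ w = 0)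
    (hdim : Module.finrank ℝ E + Module.finrank ℝ W = Module.finrank ℝ V) :
    ∃ Γ : OpenPartialHomeomorph ((E × W) × ℝ) (V × ℝ),
      IsDiffeoGerm Γ (zeroSection W q) (g q, q.2) ∧
      ∀ z, Γ z = (g (dropFiber W z) + j z.1.2, z.2) := by
  let jf : (E × W) × ℝ →L[ℝ] V :=
    j.comp ((ContinuousLinearMap.snd ℝ E W).comp (ContinuousLinearMap.fst ℝ (E × W) ℝ))
  let γ : (E × W) × ℝ → V × ℝ := fun z => (g (dropFiber W z) + jf z, z.2)
  have hgd : IsSmoothGerm (g ∘ dropFiber W) (zeroSection W q) :=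
    IsSmoothGerm.comp (by rwa [dropFiber_zeroSection])
      ((dropFiber (E := E) W).contDiff.isSmoothGerm _)
  have hγs : IsSmoothGerm γ (zeroSection W q) :=
    (hgd.add (jf.contDiff.isSmoothGerm _)).prodMk (contDiff_snd.isSmoothGerm _)
  have hgd' : HasFDerivAt (g ∘ dropFiber W) ((fderiv ℝ g q).comp (dropFiber W))
      (zeroSection W q) :=
    HasFDerivAt.comp (g := g) (f := dropFiber (E := E) W) (zeroSection W q)
      hg.differentiableAt.hasFDerivAt (dropFiber (E := E) W).hasFDerivAt
  have hγd : HasFDerivAt γ (((fderiv ℝ g q).comp (dropFiber W) + jf).prod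
      (ContinuousLinearMap.snd ℝ (E × W) ℝ)) (zeroSection W q) :=
    (hgd'.add jf.hasFDerivAt).prodMk hasFDerivAt_snd
  have hbase : γ (zeroSection W q) = (g q, q.2) := by
    change (g q + j 0, q.2) = (g q, q.2)
    rw [map_zero, add_zero]
  obtain ⟨Γ, hΓ, hΓγ⟩ := hγs.exists_isDiffeoGerm (by
    rw [hγd.fderiv]
    refine (injective_iff_map_eq_zero _).2 fun ⟨⟨u, w⟩, t⟩ hx => ?_
    obtain ⟨h1, h2⟩ := Prod.mk.inj hx
    obtain rfl : t = 0 := h2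
    obtain ⟨rfl, rfl⟩ := hj u w h1
    rfl) (by simp only [Module.finrank_prod]; omega)
  rw [hbase] at hΓ
  exact ⟨Γ, hΓ, fun z => by rw [hΓγ]; rfl⟩

theorem IsImmersedFamily.exists_straightening {s m : ℕ} {U : Set (Fin s → ℝ)} {I : Set ℝ}
    {g : (Fin s → ℝ) × ℝ → (Fin m → ℝ)} (hg : IsImmersedFamily U I g) {q : (Fin s → ℝ) × ℝ}
    (hq : q ∈ U ×ˢ I) :
    ∃ Γ : OpenPartialHomeomorph (((Fin s → ℝ) × (Fin (m - s) → ℝ)) × ℝ) ((Fin m → ℝ) × ℝ),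
      IsDiffeoGerm Γ (zeroSection _ q) (g q, q.2) ∧ (∀ z, (Γ z).2 = z.2) ∧
      (∀ p, Γ (zeroSection _ p) = graphMap g p) ∧
      ∀ᶠ z in 𝓝 (zeroSection _ q), Γ z ∈ graphMap g '' (U ×ˢ I) ↔ z.1.2 = 0 := by
  have hUI : IsOpen (U ×ˢ I) := hg.isOpen_space.prod hg.isOpen_time
  have hgs : IsSmoothGerm g q := hg.smooth.isSmoothGerm hUI hq
  have hinj : Function.Injective
      ((fderiv ℝ g q).comp (ContinuousLinearMap.inl ℝ (Fin s → ℝ) ℝ)) := by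
    have h1 : HasFDerivAt (fun u : Fin s → ℝ => (u, q.2)) (ContinuousLinearMap.inl ℝ _ ℝ) q.1 :=
      hasFDerivAt_prodMk_left q.1 q.2
    have h2 : HasFDerivAt g (fderiv ℝ g q) (q.1, q.2) := hgs.differentiableAt.hasFDerivAt
    rw [← (h2.comp q.1 h1).fderiv]
    exact hg.immersion q.1 hq.1 q.2 hq.2
  obtain ⟨hsm, j, hj⟩ := LinearMap.exists_complement_injective
    ((fderiv ℝ g q).comp (ContinuousLinearMap.inl ℝ (Fin s → ℝ) ℝ)).toLinearMap hinj
  obtain ⟨Γ, hΓ, hΓγ⟩ := hgs.exists_isDiffeoGerm_add_fiber j.toContinuousLinearMap hj (by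
    simp only [Module.finrank_fin_fun]; omega)
  have hΓz : ∀ p, Γ (zeroSection _ p) = graphMap g p := fun p => by
    rw [hΓγ, dropFiber_zeroSection, zeroSection_apply, map_zero, add_zero]
    rfl
  refine ⟨Γ, hΓ, fun z => by rw [hΓγ], hΓz, ?_⟩
  -- The embedding hypothesis enters here: image points close to the base point come from parameters
  -- close to `q`, so injectivity of `Γ` on its source forces them onto the zero section.
  have hnear : ∀ᶠ y in 𝓝 (g q, q.2), ∀ p ∈ U ×ˢ I, graphMap g p = y →
      zeroSection _ p ∈ Γ.source := by
    have h1 : ∀ᶠ p : ↥(U ×ˢ I) in 𝓝 ⟨q, hq⟩, zeroSection (Fin (m - s) → ℝ) (p : _ × ℝ) ∈ Γ.source :=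
      (continuous_subtype_val.tendsto (⟨q, hq⟩ : ↥(U ×ˢ I))).eventually
        ((tendsto_zeroSection q).eventually hΓ.eventually_source)
    rw [hg.embedding.nhds_eq_comap, eventually_comap] at h1
    filter_upwards [h1] with y hy p hp hpy using hy ⟨p, hp⟩ hpy
  filter_upwards [hΓ.tendsto.eventually hnear, hΓ.eventually_source,
    (tendsto_dropFiber q).eventually (hUI.mem_nhds hq)] with z h1 h2 h3
  constructor
  · rintro ⟨p, hp, hpz⟩
    have h4 := h1 p hp hpz
    rw [← hΓz p] at hpz
    rw [← Γ.injOn h4 h2 hpz]; rfl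
  · intro hz
    refine ⟨dropFiber _ z, h3, ?_⟩
    rw [← hΓz, zeroSection_dropFiber hz]

/-! ### The parametric version of Montaldi's theorem -/

theorem IsSubmersionGerm.isSmoothGerm_fst {m : ℕ} {f : (Fin m → ℝ) → ℝ} {y : Fin m → ℝ}
    (hf : IsSubmersionGerm f y) (t : ℝ) :
    IsSmoothGerm (fun z : (Fin m → ℝ) × ℝ => f z.1) (y, t) :=
  IsSmoothGerm.comp (g := f) (f := Prod.fst) hf.smooth (contDiff_fst.isSmoothGerm (y, t))

theorem IsSubmersionGerm.fderiv_fst {m : ℕ} {f : (Fin m → ℝ) → ℝ} {y : Fin m → ℝ}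
    (hf : IsSubmersionGerm f y) (t : ℝ) (p : (Fin m → ℝ) × ℝ) :
    fderiv ℝ (fun z : (Fin m → ℝ) × ℝ => f z.1) (y, t) p = fderiv ℝ f y p.1 := by
  have h : HasFDerivAt f (fderiv ℝ f y) ((y, t) : (Fin m → ℝ) × ℝ).1 :=
    hf.smooth.differentiableAt.hasFDerivAt
  exact DFunLike.congr_fun (h.comp (y, t) hasFDerivAt_fst).fderiv p

/-- A diffeomorphism germ that maps the zero set of a submersion to the zero set of another one
multiplies the submersion by a unit. -/
theorem IsSubmersionGerm.exists_eq_unit_mul {m : ℕ} {f₁ f₂ : (Fin m → ℝ) → ℝ}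
    {y₁ y₂ : Fin m → ℝ} {t₁ t₂ : ℝ} (hf₁ : IsSubmersionGerm f₁ y₁) (hf₂ : IsSubmersionGerm f₂ y₂)
    {Φ : OpenPartialHomeomorph ((Fin m → ℝ) × ℝ) ((Fin m → ℝ) × ℝ)}
    (hΦ : IsDiffeoGerm Φ (y₁, t₁) (y₂, t₂))
    (hz : ∀ᶠ z in 𝓝 (y₁, t₁), f₁ z.1 = 0 → f₂ (Φ z).1 = 0) :
    ∃ μ : (Fin m → ℝ) × ℝ → ℝ, IsSmoothGerm μ (y₁, t₁) ∧ μ (y₁, t₁) ≠ 0 ∧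
      ∀ᶠ z in 𝓝 (y₁, t₁), f₂ (Φ z).1 = μ z * f₁ z.1 := by
  have hF := hf₁.isSmoothGerm_fst t₁
  have hF₂ := hf₂.isSmoothGerm_fst t₂
  rw [← hΦ.map_base] at hF₂
  have hG : IsSmoothGerm (fun z => f₂ (Φ z).1) (y₁, t₁) := hF₂.comp hΦ.isSmoothGerm
  have hdF : fderiv ℝ (fun z : (Fin m → ℝ) × ℝ => f₁ z.1) (y₁, t₁) ≠ 0 := fun h => by
    obtain ⟨e, he⟩ := hf₁.submersion 1
    have h1 := hf₁.fderiv_fst t₁ (e, 0)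
    rw [h, he] at h1
    exact zero_ne_one h1
  obtain ⟨μ, hμ, hμF⟩ := hF.exists_eq_mul hG hf₁.map_base hdF hz
  -- If `μ` vanished at the base point, where `f₁` also vanishes, the product rule would make the
  -- derivative of `f₂ ∘ Φ` zero there.
  refine ⟨μ, hμ, fun h0 => ?_, hμF⟩
  obtain ⟨e, he⟩ := hf₂.submersion 1
  obtain ⟨p, hp⟩ := hΦ.bijective_fderiv.2 (e, 0)
  have h1 := (hF₂.differentiableAt.hasFDerivAt.comp _
    hΦ.isSmoothGerm.differentiableAt.hasFDerivAt).fderiv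
  have h2 := (hμ.differentiableAt.hasFDerivAt.mul hF.differentiableAt.hasFDerivAt).fderiv
  rw [h0, hf₁.map_base, zero_smul, zero_smul, add_zero] at h2
  have h3 := DFunLike.congr_fun (h1.symm.trans ((EventuallyEq.fderiv_eq hμF).trans h2)) p
  rw [ContinuousLinearMap.comp_apply, hp, hΦ.map_base, hf₂.fderiv_fst, he] at h3
  exact one_ne_zero h3

/-! ### From contact to `P`-`𝒦`-equivalence -/

theorem PKEquivalent.of_sameContactType {s m : ℕ} {U₁ U₂ : Set (Fin s → ℝ)} {I₁ I₂ : Set ℝ}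
    {g₁ g₂ : (Fin s → ℝ) × ℝ → (Fin m → ℝ)} {q₁ q₂ : (Fin s → ℝ) × ℝ}
    {f₁ f₂ : (Fin m → ℝ) → ℝ} (hg₁ : IsImmersedFamily U₁ I₁ g₁) (hg₂ : IsImmersedFamily U₂ I₂ g₂)
    (hq₁ : q₁ ∈ U₁ ×ˢ I₁) (hq₂ : q₂ ∈ U₂ ×ˢ I₂)
    (hf₁ : IsSubmersionGerm f₁ (g₁ q₁)) (hf₂ : IsSubmersionGerm f₂ (g₂ q₂))
    (h : SameContactType
      (graphMap g₁ '' (U₁ ×ˢ I₁)) ((f₁ ⁻¹' {0}) ×ˢ I₁) (g₁ q₁, q₁.2)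
      (graphMap g₂ '' (U₂ ×ˢ I₂)) ((f₂ ⁻¹' {0}) ×ˢ I₂) (g₂ q₂, q₂.2)) :
    PKEquivalent (f₁ ∘ g₁) q₁ (f₂ ∘ g₂) q₂ := by
  obtain ⟨Φ, hΦ, hY, hZ⟩ := h
  obtain ⟨hΦd, φ₂, hφ₂⟩ := isParamDiffeoGerm_iff.1 hΦ
  obtain ⟨Γ₁, hΓ₁, hΓ₁t, hΓ₁z, hΓ₁Y⟩ := hg₁.exists_straightening hq₁
  obtain ⟨Γ₂, hΓ₂, hΓ₂t, hΓ₂z, hΓ₂Y⟩ := hg₂.exists_straightening hq₂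
  -- In straightened coordinates `Φ` preserves the zero section; its restriction there is the
  -- required `Ψ`.
  have hΩ := (hΓ₁.trans hΦd).trans hΓ₂.symm
  have hΩΓ : ∀ z ∈ ((Γ₁.trans Φ).trans Γ₂.symm).source,
      Γ₁ z ∈ Φ.source ∧ Γ₂ ((Γ₁.trans Φ).trans Γ₂.symm z) = Φ (Γ₁ z) := fun z hz => by
    rw [OpenPartialHomeomorph.trans_source, OpenPartialHomeomorph.trans_source] at hz
    exact ⟨hz.1.2, Γ₂.right_inv hz.2⟩
  generalize (Γ₁.trans Φ).trans Γ₂.symm = Ω at hΩ hΩΓ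
  obtain ⟨Ψ, hΨ, hΨΩ⟩ := hΩ.exists_restrict (by
    filter_upwards [hΓ₁Y, hΓ₁.tendsto.eventually hY, hΩ.tendsto.eventually hΓ₂Y,
      hΩ.eventually_source] with z h1 h2 h3 h4
    rw [← h1, h2, ← h3, (hΩΓ z h4).2])
  have hΨΦ : ∀ q ∈ Ψ.source, graphMap g₁ q ∈ Φ.source ∧
      graphMap g₂ (Ψ q) = Φ (graphMap g₁ q) := fun q hq => by
    obtain ⟨h1, h2⟩ := hΨΩ q hq
    obtain ⟨h3, h4⟩ := hΩΓ _ h1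
    rw [hΓ₁z] at h3 h4
    exact ⟨h3, by rw [← hΓ₂z, h2, h4]⟩
  have hI₁ : ∀ᶠ z in 𝓝 (g₁ q₁, q₁.2), z.2 ∈ I₁ :=
    (continuous_snd.tendsto (g₁ q₁, q₁.2)).eventually (hg₁.isOpen_time.mem_nhds hq₁.2)
  obtain ⟨μ, hμ, hμ0, hμf⟩ := hf₁.exists_eq_unit_mul hf₂ hΦd (by
    filter_upwards [hZ, hI₁] with z h1 h2 h3
    exact (h1.1 ⟨h3, h2⟩).1)
  have hgraph : IsSmoothGerm (graphMap g₁) q₁ :=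
    (hg₁.smooth.isSmoothGerm (hg₁.isOpen_space.prod hg₁.isOpen_time) hq₁).prodMk
      (contDiff_snd.isSmoothGerm _)
  refine ⟨Ψ, μ ∘ graphMap g₁, isParamDiffeoGerm_iff.2 ⟨hΨ, φ₂, fun q hq => ?_⟩,
    IsSmoothGerm.comp hμ hgraph, hμ0, ?_⟩
  · obtain ⟨h1, h2⟩ := hΨΦ q hq
    have h3 := hφ₂ _ h1
    rw [← h2] at h3
    exact h3
  · have htend : Tendsto (graphMap g₁) (𝓝 q₁) (𝓝 (g₁ q₁, q₁.2)) := hgraph.continuousAt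
    filter_upwards [htend.eventually hμf, hΨ.eventually_source] with q h1 h2
    rw [← (hΨΦ q h2).2] at h1
    exact h1

/-! ### From `P`-`𝒦`-equivalence to contact -/

/-- The derivative of a diffeomorphism germ `(ψ₁ (u, t), ψ₂ t)` maps `E × {0}` onto itself. -/
theorem IsParamDiffeoGerm.exists_fderiv_eq {E : Type*} [NormedAddCommGroup E] [NormedSpace ℝ E]
    [FiniteDimensional ℝ E] {Ψ : OpenPartialHomeomorph (E × ℝ) (E × ℝ)} {q₁ q₂ : E × ℝ}
    (h : IsParamDiffeoGerm Ψ q₁ q₂) (u : E) : ∃ u', fderiv ℝ Ψ q₁ (u', 0) = (u, 0) := by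
  obtain ⟨hΨ, φ₂, hφ₂⟩ := isParamDiffeoGerm_iff.1 h
  have hd := hΨ.isSmoothGerm.differentiableAt.hasFDerivAt
  -- For fixed time the second component of `Ψ` is the constant `φ₂ q₁.2`.
  have hzero : ∀ u', (fderiv ℝ Ψ q₁ (u', 0)).2 = 0 := by
    intro u'
    have h1 : HasFDerivAt (fun u : E => (u, q₁.2)) (ContinuousLinearMap.inl ℝ E ℝ) q₁.1 :=
      hasFDerivAt_prodMk_left q₁.1 q₁.2
    have h2 : HasFDerivAt (fun u : E => (Ψ (u, q₁.2)).2) _ q₁.1 :=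
      (HasFDerivAt.comp (g := Ψ) q₁.1 hd h1).snd
    have h3 : (fun u : E => (Ψ (u, q₁.2)).2) =ᶠ[𝓝 q₁.1] fun _ => φ₂ q₁.2 := by
      have h4 : Tendsto (fun u : E => (u, q₁.2)) (𝓝 q₁.1) (𝓝 q₁) := h1.continuousAt
      filter_upwards [h4.eventually hΨ.eventually_source] with u hu using hφ₂ _ hu
    exact DFunLike.congr_fun (h2.unique ((hasFDerivAt_const _ _).congr_of_eventuallyEq h3)) u'
  let T : E →ₗ[ℝ] E :=
    LinearMap.fst ℝ E ℝ ∘ₗ (fderiv ℝ Ψ q₁).toLinearMap ∘ₗ LinearMap.inl ℝ E ℝ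
  have hT : Function.Injective T := by
    refine (injective_iff_map_eq_zero _).2 fun x hx => ?_
    have h1 : fderiv ℝ Ψ q₁ (x, 0) = 0 := Prod.ext hx (hzero x)
    exact congrArg Prod.fst (hΨ.bijective_fderiv.1 (h1.trans (map_zero _).symm))
  obtain ⟨u', hu'⟩ := LinearMap.injective_iff_surjective.1 hT u
  exact ⟨u', Prod.ext hu' (hzero u')⟩

/-- In straightened coordinates, a submersion has a nonzero derivative along some direction without
time component. -/
theorem IsSubmersionGerm.exists_fderiv_comp_ne_zero {m : ℕ} {f : (Fin m → ℝ) → ℝ}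
    {y : Fin m → ℝ} {t : ℝ} (hf : IsSubmersionGerm f y) {X : Type*} [NormedAddCommGroup X]
    [NormedSpace ℝ X] {Γ : OpenPartialHomeomorph (X × ℝ) ((Fin m → ℝ) × ℝ)} {a : X × ℝ}
    (hΓ : IsDiffeoGerm Γ a (y, t)) (hΓt : ∀ z, (Γ z).2 = z.2) :
    ∃ x : X, fderiv ℝ (fun z => f (Γ z).1) a (x, 0) ≠ 0 := by
  have hd := hΓ.isSmoothGerm.differentiableAt.hasFDerivAt
  have hF := hf.isSmoothGerm_fst t
  rw [← hΓ.map_base] at hF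
  have h1 : fderiv ℝ (fun z => f (Γ z).1) a = _ := (hF.differentiableAt.hasFDerivAt.comp _ hd).fderiv
  obtain ⟨e, he⟩ := hf.submersion 1
  obtain ⟨p, hp⟩ := hΓ.bijective_fderiv.2 (e, 0)
  -- Since `Γ` preserves time, the preimage of a vector without time component has none either.
  have h2 : (fderiv ℝ Γ a p).2 = p.2 := by
    have h3 : HasFDerivAt (fun z : X × ℝ => z.2) _ a :=
      hd.snd.congr_of_eventuallyEq (Eventually.of_forall fun z => (hΓt z).symm)
    exact DFunLike.congr_fun (h3.unique hasFDerivAt_snd) p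
  rw [hp] at h2
  refine ⟨p.1, ?_⟩
  have h4 : (p.1, (0 : ℝ)) = p := Prod.ext rfl h2
  rw [h4, h1, ContinuousLinearMap.comp_apply, hp, hΓ.map_base, hf.fderiv_fst, he]
  exact one_ne_zero

/-- `P`-`𝒦`-equivalence on the zero section extends to a diffeomorphism germ preserving the zero
section and mapping the zero set of `A` to the zero set of `B`. -/
theorem exists_isDiffeoGerm_of_pkEquivalent {E W : Type*} [NormedAddCommGroup E] [NormedSpace ℝ E]
    [FiniteDimensional ℝ E] [NormedAddCommGroup W] [NormedSpace ℝ W] [FiniteDimensional ℝ W]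
    {A B : (E × W) × ℝ → ℝ} {q₁ q₂ : E × ℝ}
    (hA : IsSmoothGerm A (zeroSection W q₁)) (hB : IsSmoothGerm B (zeroSection W q₂))
    (hA0 : A (zeroSection W q₁) = 0)
    (hdA : ∃ x, fderiv ℝ A (zeroSection W q₁) (x, 0) ≠ 0)
    (hdB : ∃ x, fderiv ℝ B (zeroSection W q₂) (x, 0) ≠ 0)
    (h : PKEquivalent (A ∘ zeroSection W) q₁ (B ∘ zeroSection W) q₂) :
    ∃ Ω : OpenPartialHomeomorph ((E × W) × ℝ) ((E × W) × ℝ),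
      IsDiffeoGerm Ω (zeroSection W q₁) (zeroSection W q₂) ∧
      (∃ φ₂ : ℝ → ℝ, ∀ z ∈ Ω.source, (Ω z).2 = φ₂ z.2) ∧
      (∀ᶠ z in 𝓝 (zeroSection W q₁), z.1.2 = 0 ↔ (Ω z).1.2 = 0) ∧
      ∀ᶠ z in 𝓝 (zeroSection W q₁), A z = 0 ↔ B (Ω z) = 0 := by
  obtain ⟨Ψ, l, hΨp, hl, hl0, hΨl⟩ := h
  obtain ⟨hΨ, φ₂, hφ₂⟩ := isParamDiffeoGerm_iff.1 hΨp
  obtain ⟨Ψ', hΨ', hΨ's, hΨ'e⟩ := hΨ.exists_extend (W := W)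
  have hlW : IsSmoothGerm (l ∘ dropFiber W) (zeroSection W q₁) :=
    IsSmoothGerm.comp (by rwa [dropFiber_zeroSection])
      ((dropFiber (E := E) W).contDiff.isSmoothGerm _)
  have hF : IsSmoothGerm (fun z => (l ∘ dropFiber W) z * A z) (zeroSection W q₁) := hlW.mul hA
  have hB' := hB
  rw [← hΨ'.map_base] at hB'
  have hG : IsSmoothGerm (B ∘ Ψ') (zeroSection W q₁) := hB'.comp hΨ'.isSmoothGerm
  -- Only this term of the product rule survives, because `A` vanishes at the base point.
  have hdF : ∀ p, fderiv ℝ (fun z => (l ∘ dropFiber W) z * A z) (zeroSection W q₁) p =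
      l q₁ * fderiv ℝ A (zeroSection W q₁) p := fun p => by
    have h1 := (hlW.differentiableAt.hasFDerivAt.mul hA.differentiableAt.hasFDerivAt).fderiv
    rw [hA0, zero_smul, add_zero] at h1
    exact DFunLike.congr_fun h1 p
  have hdG : ∀ w : W, fderiv ℝ (B ∘ Ψ') (zeroSection W q₁) ((0, w), 0) =
      fderiv ℝ B (zeroSection W q₂) ((0, w), 0) := fun w => by
    -- On the fibre through the base point `Ψ'` is the translation-like map `(q₁, w) ↦ (q₂, w)`, so
    -- the two functions agree along the whole line.
    rw [← hG.differentiableAt.lineDeriv_eq_fderiv, ← hB.differentiableAt.lineDeriv_eq_fderiv]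
    unfold lineDeriv
    congr 1
    funext c
    have h1 : dropFiber W (zeroSection W q₁ + c • ((0, w), (0 : ℝ))) = q₁ := by
      simp [dropFiber_apply, zeroSection_apply]
    rw [Function.comp_apply, hΨ'e, h1, hΨ.map_base]
    simp [zeroSection_apply]
  have hΨ'z : ∀ q, Ψ' (zeroSection W q) = zeroSection W (Ψ q) := fun q => hΨ'e _
  have hFG : (fun z => (l ∘ dropFiber W) z * A z) ∘ zeroSection W =ᶠ[𝓝 q₁]
      (B ∘ Ψ') ∘ zeroSection W := by
    filter_upwards [hΨl] with q hq
    change _ = B (Ψ' (zeroSection W q))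
    rw [hΨ'z]
    exact hq.symm
  have hsplit : ∀ (D : (E × W) × ℝ →L[ℝ] ℝ) (x : E × W), D (x, 0) = D ((x.1, 0), 0) + D ((0, x.2), 0) :=
    fun D x => by rw [← map_add]; simp
  obtain ⟨Θ, hΘ, hΘF, hΘ0⟩ := exists_isDiffeoGerm_preserving_zeroSection hF hG hFG (by
    by_cases hE : ∃ e : E, fderiv ℝ A (zeroSection W q₁) ((e, 0), 0) ≠ 0
    · obtain ⟨e, he⟩ := hE
      exact Or.inl ⟨e, by rw [hdF]; exact mul_ne_zero hl0 he⟩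
    · push Not at hE
      -- Differentiate the equivalence at `q₁`: the derivative of `A` vanishes on `u`-directions,
      -- and that of `Ψ` maps these onto the `u`-directions at `q₂`.
      have hBE : ∀ u : E, fderiv ℝ B (zeroSection W q₂) ((u, 0), 0) = 0 := by
        intro u
        obtain ⟨u', hu'⟩ := hΨp.exists_fderiv_eq u
        have hBz : HasFDerivAt (B ∘ zeroSection W)
            ((fderiv ℝ B (zeroSection W q₂)).comp (zeroSection W)) (Ψ q₁) := by
          rw [hΨ.map_base]
          exact HasFDerivAt.comp (g := B) (f := zeroSection (E := E) W) q₂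
            hB.differentiableAt.hasFDerivAt (zeroSection (E := E) W).hasFDerivAt
        have h1 := (hBz.comp q₁ hΨ.isSmoothGerm.differentiableAt.hasFDerivAt).fderiv
        have h2 : (B ∘ zeroSection W) ∘ Ψ =ᶠ[𝓝 q₁]
            (fun z => (l ∘ dropFiber W) z * A z) ∘ zeroSection W := hΨl
        have h3 := fderiv_zeroSection_comp hF (u', 0)
        rw [← h2.fderiv_eq, h1, hdF, ContinuousLinearMap.comp_apply, hu'] at h3
        have h4 : fderiv ℝ A (zeroSection W q₁) (zeroSection W (u', 0)) = 0 := hE u'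
        rw [h4, mul_zero] at h3
        exact h3
      let i : W →ₗ[ℝ] (E × W) × ℝ := LinearMap.inl ℝ (E × W) ℝ ∘ₗ LinearMap.inr ℝ E W
      obtain ⟨e, h1, h2⟩ := exists_ne_zero_and_ne_zero
        ((fderiv ℝ A (zeroSection W q₁)).toLinearMap ∘ₗ i)
        ((fderiv ℝ B (zeroSection W q₂)).toLinearMap ∘ₗ i)
        (fun h0 => by
          obtain ⟨x, hx⟩ := hdA
          rw [hsplit, hE, zero_add] at hx
          exact hx (DFunLike.congr_fun h0 x.2))
        (fun h0 => by
          obtain ⟨x, hx⟩ := hdB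
          rw [hsplit, hBE, zero_add] at hx
          exact hx (DFunLike.congr_fun h0 x.2))
      exact Or.inr ⟨e, by rw [hdF]; exact mul_ne_zero hl0 h1, by rw [hdG]; exact h2⟩)
  refine ⟨Θ.trans Ψ', hΘ.trans hΨ', ⟨φ₂, fun z hz => ?_⟩, ?_, ?_⟩
  · rw [Θ.trans_source] at hz
    change (Ψ' (Θ z)).2 = φ₂ z.2
    rw [hΨ'e, ← (hΘF z hz.1).1]
    exact hφ₂ _ (hΨ's _ hz.2)
  · filter_upwards [hΘ0] with z hz
    change _ ↔ (Ψ' (Θ z)).1.2 = 0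
    rw [hz, hΨ'e]
  · filter_upwards [hΘ.eventually_source,
      (tendsto_dropFiber (W := W) q₁).eventually (hl.continuousAt.eventually_ne hl0)] with z h1 h2
    have h3 : B (Ψ' (Θ z)) = l (dropFiber W z) * A z := (hΘF z h1).2
    change _ ↔ B (Ψ' (Θ z)) = 0
    rw [h3, mul_eq_zero, or_iff_right h2]

/-- The contact diffeomorphism is `Γ₂ ∘ Ω ∘ Γ₁⁻¹`, with `Ω` matching the zero sections and the zero
sets in straightened coordinates. -/
theorem SameContactType.of_pkEquivalent {s m : ℕ} {U₁ U₂ : Set (Fin s → ℝ)} {I₁ I₂ : Set ℝ}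
    {g₁ g₂ : (Fin s → ℝ) × ℝ → (Fin m → ℝ)} {q₁ q₂ : (Fin s → ℝ) × ℝ}
    {f₁ f₂ : (Fin m → ℝ) → ℝ} (hg₁ : IsImmersedFamily U₁ I₁ g₁) (hg₂ : IsImmersedFamily U₂ I₂ g₂)
    (hq₁ : q₁ ∈ U₁ ×ˢ I₁) (hq₂ : q₂ ∈ U₂ ×ˢ I₂)
    (hf₁ : IsSubmersionGerm f₁ (g₁ q₁)) (hf₂ : IsSubmersionGerm f₂ (g₂ q₂))
    (h : PKEquivalent (f₁ ∘ g₁) q₁ (f₂ ∘ g₂) q₂) :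
    SameContactType
      (graphMap g₁ '' (U₁ ×ˢ I₁)) ((f₁ ⁻¹' {0}) ×ˢ I₁) (g₁ q₁, q₁.2)
      (graphMap g₂ '' (U₂ ×ˢ I₂)) ((f₂ ⁻¹' {0}) ×ˢ I₂) (g₂ q₂, q₂.2) := by
  obtain ⟨Γ₁, hΓ₁, hΓ₁t, hΓ₁z, hΓ₁Y⟩ := hg₁.exists_straightening hq₁
  obtain ⟨Γ₂, hΓ₂, hΓ₂t, hΓ₂z, hΓ₂Y⟩ := hg₂.exists_straightening hq₂
  have hs₁ : IsSmoothGerm (fun z => f₁ (Γ₁ z).1) (zeroSection _ q₁) :=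
    IsSmoothGerm.comp (g := fun z : (Fin m → ℝ) × ℝ => f₁ z.1)
      (by rw [hΓ₁.map_base]; exact hf₁.isSmoothGerm_fst _) hΓ₁.isSmoothGerm
  have hs₂ : IsSmoothGerm (fun z => f₂ (Γ₂ z).1) (zeroSection _ q₂) :=
    IsSmoothGerm.comp (g := fun z : (Fin m → ℝ) × ℝ => f₂ z.1)
      (by rw [hΓ₂.map_base]; exact hf₂.isSmoothGerm_fst _) hΓ₂.isSmoothGerm
  have hr₁ : (fun z => f₁ (Γ₁ z).1) ∘ zeroSection _ = f₁ ∘ g₁ := by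
    funext q; simp only [Function.comp_apply, hΓ₁z]; rfl
  have hr₂ : (fun z => f₂ (Γ₂ z).1) ∘ zeroSection _ = f₂ ∘ g₂ := by
    funext q; simp only [Function.comp_apply, hΓ₂z]; rfl
  obtain ⟨Ω, hΩ, ⟨φ₂, hφ₂⟩, hΩ0, hΩf⟩ := exists_isDiffeoGerm_of_pkEquivalent hs₁ hs₂
    (by rw [hΓ₁.map_base]; exact hf₁.map_base)
    (hf₁.exists_fderiv_comp_ne_zero hΓ₁ hΓ₁t) (hf₂.exists_fderiv_comp_ne_zero hΓ₂ hΓ₂t)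
    (by rw [hr₁, hr₂]; exact h)
  have hΦ := (hΓ₁.symm.trans hΩ).trans hΓ₂
  have hΦe : ∀ y, (Γ₁.symm.trans Ω).trans Γ₂ y = Γ₂ (Ω (Γ₁.symm y)) := fun y => rfl
  refine ⟨(Γ₁.symm.trans Ω).trans Γ₂, isParamDiffeoGerm_iff.2 ⟨hΦ, φ₂, fun y hy => ?_⟩, ?_, ?_⟩
  · rw [OpenPartialHomeomorph.trans_source, OpenPartialHomeomorph.trans_source] at hy
    rw [hΦe, hΓ₂t, hφ₂ _ hy.1.2, ← hΓ₁t, Γ₁.right_inv hy.1.1]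
  · filter_upwards [hΓ₁.symm.eventually_source, hΓ₁.symm.tendsto.eventually hΓ₁Y,
      hΓ₁.symm.tendsto.eventually hΩ0, (hΩ.tendsto.comp hΓ₁.symm.tendsto).eventually hΓ₂Y]
      with y h1 h2 h3 h4
    rw [Γ₁.right_inv h1] at h2
    rw [hΦe, h2, h3]
    exact h4.symm
  -- The time intervals are open, so near the base points membership in the factors `I₁` and `I₂` is
  -- automatic.
  · filter_upwards [hΓ₁.symm.eventually_source, hΓ₁.symm.tendsto.eventually hΩf,
      (continuous_snd.tendsto (g₁ q₁, q₁.2)).eventually (hg₁.isOpen_time.mem_nhds hq₁.2),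
      ((continuous_snd.tendsto (g₂ q₂, q₂.2)).comp hΦ.tendsto).eventually
        (hg₂.isOpen_time.mem_nhds hq₂.2)] with y h1 h2 h3 h4
    rw [Γ₁.right_inv h1] at h2
    constructor
    · rintro ⟨h5, -⟩
      exact ⟨h2.1 h5, h4⟩
    · rintro ⟨h5, -⟩
      exact ⟨h2.2 h5, h3⟩

theorem sameContactType_iff_pkEquivalent {s m : ℕ} {U₁ U₂ : Set (Fin s → ℝ)} {I₁ I₂ : Set ℝ}
    {g₁ g₂ : (Fin s → ℝ) × ℝ → (Fin m → ℝ)} {q₁ q₂ : (Fin s → ℝ) × ℝ}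
    {f₁ f₂ : (Fin m → ℝ) → ℝ} (hg₁ : IsImmersedFamily U₁ I₁ g₁) (hg₂ : IsImmersedFamily U₂ I₂ g₂)
    (hq₁ : q₁ ∈ U₁ ×ˢ I₁) (hq₂ : q₂ ∈ U₂ ×ˢ I₂)
    (hf₁ : IsSubmersionGerm f₁ (g₁ q₁)) (hf₂ : IsSubmersionGerm f₂ (g₂ q₂)) :
    SameContactType
        (graphMap g₁ '' (U₁ ×ˢ I₁)) ((f₁ ⁻¹' {0}) ×ˢ I₁) (g₁ q₁, q₁.2)
        (graphMap g₂ '' (U₂ ×ˢ I₂)) ((f₂ ⁻¹' {0}) ×ˢ I₂) (g₂ q₂, q₂.2) ↔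
      PKEquivalent (f₁ ∘ g₁) q₁ (f₂ ∘ g₂) q₂ :=
  ⟨PKEquivalent.of_sameContactType hg₁ hg₂ hq₁ hq₂ hf₁ hf₂,
    SameContactType.of_pkEquivalent hg₁ hg₂ hq₁ hq₂ hf₁ hf₂⟩

/-! ### World sheets -/

theorem IsWorldSheet.isImmersedFamily {s n : ℕ} {U : Set (Fin s → ℝ)} {I : Set ℝ}
    {X : (Fin s → ℝ) × ℝ → (Fin (n + 1) → ℝ)} (hX : IsWorldSheet U I X) :
    IsImmersedFamily U I X where
  isOpen_space := hX.isOpen_space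
  isOpen_time := hX.isOpen_time
  interval := hX.interval
  smooth := hX.smooth
  immersion u hu t ht := by
    have hq : (u, t) ∈ U ×ˢ I := ⟨hu, ht⟩
    have h1 : HasFDerivAt (fun u' : Fin s → ℝ => (u', t)) (ContinuousLinearMap.inl ℝ _ ℝ) u :=
      hasFDerivAt_prodMk_left u t
    have h2 : HasFDerivAt X (fderiv ℝ X (u, t)) (u, t) :=
      (hX.smooth.isSmoothGerm (hX.isOpen_space.prod hX.isOpen_time) hq).differentiableAt.hasFDerivAt
    have h3 : HasFDerivAt (fun u' => X (u', t)) _ u := h2.comp u h1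
    rw [h3.fderiv]
    exact (hX.immersion _ hq).comp (LinearMap.inl_injective (R := ℝ) (M := Fin s → ℝ) (M₂ := ℝ))
  embedding := by
    -- The first projection of the graph map is `X`, already an embedding, so the graph map is one
    -- too.
    have h : IsEmbedding (Prod.fst ∘ (U ×ˢ I).domRestrict (graphMap X)) := hX.embedding
    exact h.of_comp (hX.embedding.continuous.prodMk (continuous_snd.comp continuous_subtype_val))
      continuous_fst

/-- Pairing with the standard basis recovers the coordinates of `L` up to sign, so the linear part
is nonzero, hence onto `ℝ`. -/
theorem isSubmersionGerm_mink_sub {n : ℕ} {L y : Fin (n + 1) → ℝ} {c : ℝ} (hL : L ≠ 0)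
    (hy : mink y L = c) : IsSubmersionGerm (fun x => mink x L - c) y := by
  let ℓ : (Fin (n + 1) → ℝ) →L[ℝ] ℝ := ((minkForm n).flip L).toContinuousLinearMap
  have hd : HasFDerivAt (fun x => mink x L - c) ℓ y := ℓ.hasFDerivAt.sub_const c
  refine ⟨(ℓ.contDiff.sub contDiff_const).isSmoothGerm y, sub_eq_zero.2 hy, ?_⟩
  rw [hd.fderiv]
  have hne : ℓ.toLinearMap ≠ 0 := by
    intro h0
    have h0' : ∀ x, mink x L = 0 := fun x => DFunLike.congr_fun h0 x
    refine hL (funext fun i => ?_)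
    refine Fin.cases ?_ (fun k => ?_) i
    · have h := h0' timeVec
      rw [mink_comm, mink_self_timeVec] at h
      exact neg_eq_zero.1 h
    · have h := h0' (Pi.single k.succ 1)
      simpa [mink, Pi.single_apply, Fin.succ_ne_zero, (Fin.succ_ne_zero _).symm] using h
  exact LinearMap.surjective hne

theorem lightconeGauss_zero {s n : ℕ} (X : (Fin s → ℝ) × ℝ → (Fin (n + 1) → ℝ))
    (q : (Fin s → ℝ) × ℝ) (ξ : Fin (n + 1) → ℝ) : lightconeGauss X q ξ 0 = 1 := rfl

theorem lightconePedal_zero {s n : ℕ} (X : (Fin s → ℝ) × ℝ → (Fin (n + 1) → ℝ))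
    (q : (Fin s → ℝ) × ℝ) (ξ : Fin (n + 1) → ℝ) :
    lightconePedal X q ξ 0 = mink (X q) (lightconeGauss X q ξ) := by
  rw [lightconePedal, Pi.smul_apply, lightconeGauss_zero, smul_eq_mul, mul_one]

/-- The pedal point is a multiple of the Gauss vector, whose zeroth coordinate is `1`; dividing by
the multiple `v₀ ≠ 0` returns that vector. -/
theorem normalized_lightconePedal {s n : ℕ} {X : (Fin s → ℝ) × ℝ → (Fin (n + 1) → ℝ)}
    {q : (Fin s → ℝ) × ℝ} {ξ : Fin (n + 1) → ℝ} (h : lightconePedal X q ξ 0 ≠ 0) :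
    normalized (lightconePedal X q ξ) = lightconeGauss X q ξ := by
  have h' := h
  rw [lightconePedal_zero] at h'
  funext i
  refine Fin.cases ?_ (fun k => ?_) i
  · rfl
  · change lightconePedal X q ξ k.succ / lightconePedal X q ξ 0 = _
    rw [lightconePedal_zero, lightconePedal, Pi.smul_apply, smul_eq_mul, mul_div_cancel_left₀ _ h']

theorem isSubmersionGerm_extendedHeight {s n : ℕ} {X : (Fin s → ℝ) × ℝ → (Fin (n + 1) → ℝ)}
    {q : (Fin s → ℝ) × ℝ} {ξ : Fin (n + 1) → ℝ} (h : lightconePedal X q ξ ∈ lightcone n) :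
    IsSubmersionGerm (fun x => mink x (normalized (lightconePedal X q ξ)) - lightconePedal X q ξ 0)
      (X q) := by
  refine isSubmersionGerm_mink_sub (fun h0 => ?_) ?_
  · exact one_ne_zero (congrFun h0 0)
  · rw [normalized_lightconePedal h.1, lightconePedal_zero]

theorem tangentLightlikeHyperplane_eq_preimage {s n : ℕ}
    (X : (Fin s → ℝ) × ℝ → (Fin (n + 1) → ℝ)) (q : (Fin s → ℝ) × ℝ) (ξ : Fin (n + 1) → ℝ) :
    tangentLightlikeHyperplane X q ξ =
      (fun x => mink x (normalized (lightconePedal X q ξ)) - lightconePedal X q ξ 0) ⁻¹' {0} := by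
  ext x
  exact sub_eq_zero.symm

theorem proposition5p3 (s n : ℕ) :
    -- the parametric version of Montaldi's theorem
    (∀ (U₁ U₂ : Set (Fin s → ℝ)) (I₁ I₂ : Set ℝ)
      (g₁ g₂ : (Fin s → ℝ) × ℝ → (Fin n → ℝ)) (q₁ q₂ : (Fin s → ℝ) × ℝ)
      (f₁ f₂ : (Fin n → ℝ) → ℝ),
      IsImmersedFamily U₁ I₁ g₁ → IsImmersedFamily U₂ I₂ g₂ →
      q₁ ∈ U₁ ×ˢ I₁ → q₂ ∈ U₂ ×ˢ I₂ →
      IsSubmersionGerm f₁ (g₁ q₁) → IsSubmersionGerm f₂ (g₂ q₂) →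
      (SameContactType
          (graphMap g₁ '' (U₁ ×ˢ I₁)) ((f₁ ⁻¹' {0}) ×ˢ I₁) (g₁ q₁, q₁.2)
          (graphMap g₂ '' (U₂ ×ˢ I₂)) ((f₂ ⁻¹' {0}) ×ˢ I₂) (g₂ q₂, q₂.2) ↔
        PKEquivalent (f₁ ∘ g₁) q₁ (f₂ ∘ g₂) q₂)) ∧
    -- the statement on world sheets
    (∀ (U₁ U₂ : Set (Fin s → ℝ)) (I₁ I₂ : Set ℝ)
      (X₁ X₂ : (Fin s → ℝ) × ℝ → (Fin (n + 1) → ℝ)) (q₁ q₂ : (Fin s → ℝ) × ℝ)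
      (ξ₁ ξ₂ v₁ v₂ : Fin (n + 1) → ℝ),
      IsWorldSheet U₁ I₁ X₁ → IsWorldSheet U₂ I₂ X₂ →
      q₁ ∈ U₁ ×ˢ I₁ → q₂ ∈ U₂ ×ˢ I₂ →
      ξ₁ ∈ unitNormals X₁ q₁ → ξ₂ ∈ unitNormals X₂ q₂ →
      v₁ = lightconePedal X₁ q₁ ξ₁ → v₂ = lightconePedal X₂ q₂ ξ₂ →
      v₁ ∈ lightcone n → v₂ ∈ lightcone n →
      (SameContactType
          (graphMap X₁ '' (U₁ ×ˢ I₁)) (tangentLightlikeHyperplane X₁ q₁ ξ₁ ×ˢ I₁) (X₁ q₁, q₁.2)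
          (graphMap X₂ '' (U₂ ×ˢ I₂)) (tangentLightlikeHyperplane X₂ q₂ ξ₂ ×ˢ I₂) (X₂ q₂, q₂.2) ↔
        PKEquivalent (extendedHeight X₁ v₁) q₁ (extendedHeight X₂ v₂) q₂)) := by
  refine ⟨fun U₁ U₂ I₁ I₂ g₁ g₂ q₁ q₂ f₁ f₂ hg₁ hg₂ hq₁ hq₂ hf₁ hf₂ =>
    sameContactType_iff_pkEquivalent hg₁ hg₂ hq₁ hq₂ hf₁ hf₂, ?_⟩
  rintro U₁ U₂ I₁ I₂ X₁ X₂ q₁ q₂ ξ₁ ξ₂ v₁ v₂ hX₁ hX₂ hq₁ hq₂ - - rfl rfl hv₁ hv₂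
  -- With the hyperplanes written as zero sets of affine functions, whose composites with `X₁` and
  -- `X₂` are by definition the extended heights, this is the parametric theorem in `ℝⁿ⁺¹`.
  rw [tangentLightlikeHyperplane_eq_preimage, tangentLightlikeHyperplane_eq_preimage]
  exact sameContactType_iff_pkEquivalent hX₁.isImmersedFamily hX₂.isImmersedFamily hq₁ hq₂
    (isSubmersionGerm_extendedHeight hv₁) (isSubmersionGerm_extendedHeight hv₂)
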